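/- For a graph $G=(V,E)$ and $z\in\mathbb{C}^V$ let $Z_G(z)=\sum_{I\text{ independent}}\prod_{v\in I}z_v$ be the independence polynomial, and for $p\in\mathbb{C}^V$ let $\breve q_V(p)=\sum_{I\text{ independent}}(-1)^{|I|}\prod_{v\in I}p_v=Z_G(-p)$. The Shearer region is $$\mathcal{S}_G=\{p\in[0,1]^V : Z_G(z)\neq 0\ \ \forall z\in\mathbb{C}^V\text{ with }|z_v|\le p_v\text{ for all }v\},$$ and the complex Shearer region is $\mathcal{S}_G^{\mathbb{C}}=\{p\in\mathbb{C}^V : Z_G(z)\neq 0\ \ \forall z\in\mathbb{C}^V\text{ with }|z_v|\le |p_v|\text{ for all }v\}$. Weitz's truncated recursion: for $S\subseteq V$, $u\in S$ and the neighbours $w_1<\dots<w_k$ of $u$ in $S$ put $R^{0}_{S,u}(p)=0$ and $$R^{\ell+1}_{S,u}(p)=p_u\prod_{i=1}^{k}\frac{1}{1-R^{\ell}_{S\setminus\{u,w_1,\dots,w_{i-1}\},\,w_i}(p)} .$$ With $V=\{v_1<\dots<v_n\}$, the estimate of recursion depth $\ell$ is $\breve Q^{\ell}(p)=\prod_{i=1}^n\bigl(1-R^{\ell}_{\{v_i,\dots,v_n\},v_i}(p)\bigr)$.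 Theorem. There are an absolute constant $C>0$, a depth function $\ell=\ell(n,d,\alpha,\epsilon)\in\mathbb{N}$ and one deterministic program for a unit-cost random access machine (exact field arithmetic on complex numbers, comparison of real parts, addition, truncated subtraction and comparison of integers, memory access, conditionals, loops and recursive procedures, queries to the input; division by zero is not allowed) such that the following holds for every $n$-vertex graph $G$ with vertex set $\{0,\dots,n-1\}$ and maximum degree $d$ and all $\alpha,\epsilon\in(0,1]$. Write $B=\max\{2,\,n/(\epsilon\alpha)\}$ and $D=\max\{2,d\}$. Then $$\ell\le \frac{C}{\sqrt\alpha}\,\log B ,$$ and: 1. for every $z\in\mathbb{C}^V$ with $(1+\alpha)\cdot(|z_v|)_{v\in V}\in\mathcal{S}_G$, the program on input $(G,z,\alpha,\epsilon)$ halts after at most $B^{\,C\log (D)/\sqrt\alpha}$ steps with output $\breve Q^{\ell}(-z)$, and this is a $(1+\epsilon)$-approximation to $Z_G(z)$: $\ |\breve Q^{\ell}(-z)-Z_G(z)|\le\epsilon\,|Z_G(z)|$; 2. for every $p\in\mathbb{C}^V$ with $(1+\alpha)^2p\in\mathcal{S}_G^{\mathbb{C}}$, the program on input $(G,-p,\alpha,\epsilon)$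 halts after at most $B^{\,C\log (D)/\sqrt\alpha}$ steps with output $\breve Q^{\ell}(p)$, and $\ |\breve Q^{\ell}(p)-\breve q_V(p)|\le\epsilon\,|\breve q_V(p)|$. (For $d\ge 2$ one has $B=n/(\epsilon\alpha)$ and $D=d$, so the running time is $(n/(\epsilon\alpha))^{O(\log d/\sqrt\alpha)}$ and $\ell=O\bigl(\tfrac1{\sqrt\alpha}\log\tfrac{n}{\epsilon\alpha}\bigr)$.) -/

import Mathlib

/-- The independence polynomial `Z_G(z) = ∑_{I independent} ∏_{v ∈ I} z_v`. -/
noncomputable def indepPoly {n : ℕ} (G : SimpleGraph (Fin n)) (z : Fin n → ℂ) : ℂ :=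
  open Classical in
  ∑ I ∈ Finset.univ.filter (fun J : Finset (Fin n) => G.IsIndepSet (J : Set (Fin n))),
    ∏ v ∈ I, z v

/-- The alternating-sign independence polynomial
`q_V(p) = ∑_{I independent} (-1)^|I| ∏_{v ∈ I} p_v`. -/
noncomputable def altIndepPoly {n : ℕ} (G : SimpleGraph (Fin n)) (p : Fin n → ℂ) : ℂ :=
  open Classical in
  ∑ I ∈ Finset.univ.filter (fun J : Finset (Fin n) => G.IsIndepSet (J : Set (Fin n))),
    (-1) ^ I.card * ∏ v ∈ I, p v

/-- The Shearer region: radii `p ∈ [0,1]^V` of the closed polydiscs without zeros of `Z_G`. -/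
def shearerRegion {n : ℕ} (G : SimpleGraph (Fin n)) : Set (Fin n → ℝ) :=
  {p | (∀ v, 0 ≤ p v ∧ p v ≤ 1) ∧
    ∀ z : Fin n → ℂ, (∀ v, ‖z v‖ ≤ p v) → indepPoly G z ≠ 0}

/-- The complex Shearer region. -/
def complexShearerRegion {n : ℕ} (G : SimpleGraph (Fin n)) : Set (Fin n → ℂ) :=
  {p | ∀ z : Fin n → ℂ, (∀ v, ‖z v‖ ≤ ‖p v‖) → indepPoly G z ≠ 0}

/-- The truncated recursion for the occupation ratio of `u` in `S`. With `w_1 < ... < w_k` the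
neighbours of `u` in `S`, the subproblem of `w_i` is `(S \ {u, w_1, ..., w_{i-1}}, w_i)`;
at depth `0` the recursion returns `0`. -/
noncomputable def occupationRatio {n : ℕ} (G : SimpleGraph (Fin n)) (p : Fin n → ℂ) :
    ℕ → Finset (Fin n) → Fin n → ℂ
  | 0, _, _ => 0
  | ℓ + 1, S, u =>
    open Classical in
    p u * ∏ w ∈ S with G.Adj u w,
      1 / (1 - occupationRatio G p ℓ {x ∈ S | x ≠ u ∧ ¬ (G.Adj u x ∧ x < w)} w)

/-- Weitz's truncated-recursion estimate of `altIndepPoly G p`, with recursion depth `ℓ`: the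
product over `i` of `1 - R_i`, where `R_i` is the truncated occupation ratio of the vertex `i`
in the set `{i, i+1, ..., n-1}`. -/
noncomputable def weitzEstimate {n : ℕ} (G : SimpleGraph (Fin n)) (p : Fin n → ℂ) (ℓ : ℕ) : ℂ :=
  ∏ i : Fin n, (1 - occupationRatio G p ℓ (Finset.Ici i) i)

/-! ### The machine model

A unit-cost random access machine. It has finitely many named integer arrays and finitely many
named arrays of complex numbers, all initialised to zero, and it is programmed by a finite list of
(possibly recursive) procedures. The input (a graph, its activities, `α` and `ε`) is read-only.
Available operations are: reading the input, reading and writing memory, addition and truncated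
subtraction of integers, exact field arithmetic on complex numbers, conversion of an integer into a
number, comparison of integers, and comparison of the real parts of two numbers. Every elementary
operation costs one step. Division by zero gets the machine stuck. -/

/-- The input of the machine. -/
structure MachineInput where
  n : ℕ
  G : SimpleGraph (Fin n)
  z : Fin n → ℂ
  α : ℝ
  ε : ℝ

/-- A memory: `ints a i` is entry `i` of the integer array `a`, and `nums a i` is entry `i` of the
complex array `a`. -/
structure Memory where
  ints : ℕ → ℕ → ℕ
  nums : ℕ → ℕ → ℂ

/-- The memory at the start of a computation. -/
def Memory.zero : Memory := ⟨fun _ _ => 0, fun _ _ => 0⟩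

/-- Write `x` into entry `i` of the integer array `a`. -/
def Memory.setInt (m : Memory) (a i x : ℕ) : Memory :=
  { m with ints := Function.update m.ints a (Function.update (m.ints a) i x) }

/-- Write `x` into entry `i` of the complex array `a`. -/
noncomputable def Memory.setNum (m : Memory) (a i : ℕ) (x : ℂ) : Memory :=
  { m with nums := Function.update m.nums a (Function.update (m.nums a) i x) }

/-- Integer expressions. -/
inductive IntExpr where
  | const (k : ℕ)
  | vertexCount
  | load (a : ℕ) (i : IntExpr)
  | add (e f : IntExpr)
  | sub (e f : IntExpr)

/-- The value of an integer expression. -/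
def IntExpr.eval (I : MachineInput) (m : Memory) : IntExpr → ℕ
  | const k => k
  | vertexCount => I.n
  | load a i => m.ints a (i.eval I m)
  | add e f => e.eval I m + f.eval I m
  | sub e f => e.eval I m - f.eval I m

/-- The number of elementary operations in the evaluation of an integer expression. -/
def IntExpr.cost : IntExpr → ℕ
  | const _ => 1
  | vertexCount => 1
  | load _ i => i.cost + 1
  | add e f => e.cost + f.cost + 1
  | sub e f => e.cost + f.cost + 1

/-- Numerical expressions; `activity i` reads the activity of vertex `i`. -/
inductive NumExpr where
  | ofInt (e : IntExpr)
  | activity (i : IntExpr)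
  | alpha
  | eps
  | load (a : ℕ) (i : IntExpr)
  | add (x y : NumExpr)
  | sub (x y : NumExpr)
  | mul (x y : NumExpr)

/-- The value of a numerical expression (reading the activity of a non-vertex gives `0`). -/
noncomputable def NumExpr.eval (I : MachineInput) (m : Memory) : NumExpr → ℂ
  | ofInt e => (e.eval I m : ℂ)
  | activity i => if h : i.eval I m < I.n then I.z ⟨i.eval I m, h⟩ else 0
  | alpha => (I.α : ℂ)
  | eps => (I.ε : ℂ)
  | load a i => m.nums a (i.eval I m)
  | add x y => x.eval I m + y.eval I m
  | sub x y => x.eval I m - y.eval I m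
  | mul x y => x.eval I m * y.eval I m

/-- The number of elementary operations in the evaluation of a numerical expression. -/
def NumExpr.cost : NumExpr → ℕ
  | ofInt e => e.cost + 1
  | activity i => i.cost + 1
  | alpha => 1
  | eps => 1
  | load _ i => i.cost + 1
  | add x y => x.cost + y.cost + 1
  | sub x y => x.cost + y.cost + 1
  | mul x y => x.cost + y.cost + 1

/-- Tests: adjacency of two vertices, comparisons, and Boolean combinations. -/
inductive Test where
  | adj (e f : IntExpr)
  | intEq (e f : IntExpr)
  | intLt (e f : IntExpr)
  | reLt (x y : NumExpr)
  | neg (b : Test)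
  | conj (b c : Test)

/-- The truth value of a test. -/
def Test.Holds (I : MachineInput) (m : Memory) : Test → Prop
  | adj e f => ∃ (h : e.eval I m < I.n) (h' : f.eval I m < I.n),
      I.G.Adj ⟨e.eval I m, h⟩ ⟨f.eval I m, h'⟩
  | intEq e f => e.eval I m = f.eval I m
  | intLt e f => e.eval I m < f.eval I m
  | reLt x y => (x.eval I m).re < (y.eval I m).re
  | neg b => ¬ b.Holds I m
  | conj b c => b.Holds I m ∧ c.Holds I m

/-- The number of elementary operations in the evaluation of a test. -/
def Test.cost : Test → ℕ
  | adj e f => e.cost + f.cost + 1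
  | intEq e f => e.cost + f.cost + 1
  | intLt e f => e.cost + f.cost + 1
  | reLt x y => x.cost + y.cost + 1
  | neg b => b.cost + 1
  | conj b c => b.cost + c.cost + 1

/-- Commands. `setInt a i e` is `a[i] := e` for an integer array, `setNum a i x` is `a[i] := x` for
a complex array, `setDiv a i x y` is `a[i] := x / y` for a complex array, `loop b c` is
"while `b` do `c`", and `call k` runs procedure number `k`. -/
inductive Command where
  | skip
  | setInt (a : ℕ) (i e : IntExpr)
  | setNum (a : ℕ) (i : IntExpr) (x : NumExpr)
  | setDiv (a : ℕ) (i : IntExpr) (x y : NumExpr)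
  | seq (c d : Command)
  | branch (b : Test) (c d : Command)
  | loop (b : Test) (c : Command)
  | call (k : ℕ)

/-- A program is a finite list of procedures, which may call one another recursively. -/
abbrev Program := List Command

/-- `Exec P I c m t m'`: under program `P` and input `I`, command `c` started in memory `m` halts
after exactly `t` steps in memory `m'`. -/
inductive Exec (P : Program) (I : MachineInput) : Command → Memory → ℕ → Memory → Prop where
  | skip (m : Memory) : Exec P I .skip m 1 m
  | setInt (m : Memory) (a : ℕ) (i e : IntExpr) :
      Exec P I (.setInt a i e) m (i.cost + e.cost + 1) (m.setInt a (i.eval I m) (e.eval I m))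
  | setNum (m : Memory) (a : ℕ) (i : IntExpr) (x : NumExpr) :
      Exec P I (.setNum a i x) m (i.cost + x.cost + 1) (m.setNum a (i.eval I m) (x.eval I m))
  | setDiv (m : Memory) (a : ℕ) (i : IntExpr) (x y : NumExpr) (hy : y.eval I m ≠ 0) :
      Exec P I (.setDiv a i x y) m (i.cost + x.cost + y.cost + 2)
        (m.setNum a (i.eval I m) (x.eval I m / y.eval I m))
  | seq {c d : Command} {m m' m'' : Memory} {s t : ℕ} (hc : Exec P I c m s m')
      (hd : Exec P I d m' t m'') : Exec P I (.seq c d) m (s + t) m''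
  | branchTrue {b : Test} {c : Command} (d : Command) {m m' : Memory} {t : ℕ} (hb : b.Holds I m)
      (hc : Exec P I c m t m') : Exec P I (.branch b c d) m (b.cost + t + 1) m'
  | branchFalse {b : Test} (c : Command) {d : Command} {m m' : Memory} {t : ℕ}
      (hb : ¬ b.Holds I m) (hd : Exec P I d m t m') :
      Exec P I (.branch b c d) m (b.cost + t + 1) m'
  | loopTrue {b : Test} {c : Command} {m m' m'' : Memory} {s t : ℕ} (hb : b.Holds I m)
      (hc : Exec P I c m s m') (hl : Exec P I (.loop b c) m' t m'') :
      Exec P I (.loop b c) m (b.cost + s + t + 1) m''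
  | loopFalse {b : Test} (c : Command) {m : Memory} (hb : ¬ b.Holds I m) :
      Exec P I (.loop b c) m (b.cost + 1) m
  | call {k : ℕ} {c : Command} {m m' : Memory} {t : ℕ} (hk : P[k]? = some c)
      (hc : Exec P I c m t m') : Exec P I (.call k) m (t + 1) m'

/-- The machine is deterministic: running time and final memory are functions of the input. -/
theorem Exec.deterministic {P : Program} {I : MachineInput} {c : Command} {m m₁ m₂ : Memory}
    {t₁ t₂ : ℕ} (h₁ : Exec P I c m t₁ m₁) (h₂ : Exec P I c m t₂ m₂) : t₁ = t₂ ∧ m₁ = m₂ := by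
  induction h₁ generalizing t₂ m₂ with
  | skip => cases h₂; simp
  | setInt => cases h₂; simp
  | setNum => cases h₂; simp
  | setDiv => cases h₂; simp
  | seq _ _ ihc ihd =>
    cases h₂ with
    | seq hc hd =>
      obtain ⟨rfl, rfl⟩ := ihc hc
      obtain ⟨rfl, rfl⟩ := ihd hd
      simp
  | branchTrue d hb _ ih =>
    cases h₂ with
    | branchTrue _ _ hc => obtain ⟨rfl, rfl⟩ := ih hc; simp
    | branchFalse _ hb' _ => exact absurd hb hb'
  | branchFalse c hb _ ih =>
    cases h₂ with
    | branchTrue _ hb' _ => exact absurd hb' hb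
    | branchFalse _ _ hd => obtain ⟨rfl, rfl⟩ := ih hd; simp
  | loopTrue hb _ _ ihc ihl =>
    cases h₂ with
    | loopTrue _ hc hl =>
      obtain ⟨rfl, rfl⟩ := ihc hc
      obtain ⟨rfl, rfl⟩ := ihl hl
      simp
    | loopFalse _ hb' => exact absurd hb hb'
  | loopFalse c hb =>
    cases h₂ with
    | loopTrue hb' _ _ => exact absurd hb' hb
    | loopFalse _ _ => simp
  | call hk _ ih =>
    cases h₂ with
    | call hk' hc =>
      obtain rfl := Option.some.inj (hk.symm.trans hk')
      obtain ⟨rfl, rfl⟩ := ih hc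
      simp

/-- On input `I` the program `P`, started at its procedure `0` with zero memory, halts after at most
`T` steps with the number `out` as its output, in entry `0` of the complex array `0`. -/
def Program.OutputsWithin (P : Program) (I : MachineInput) (out : ℂ) (T : ℝ) : Prop :=
  ∃ (t : ℕ) (m : Memory), Exec P I (.call 0) Memory.zero t m ∧ m.nums 0 0 = out ∧ (t : ℝ) ≤ T

/-! ### Occupation ratios and their telescoping identities, over any field. -/

section Combinatorics

variable {n : ℕ} {K : Type*} [Field K]

/-! Write `Z_S` for the independence polynomial of the subgraph induced on `S`, at activities `-p`.
The exact ratio of `u` in `S` satisfies `1 - ratio = Z_S / Z_{S \ u}`. Deleting vertices one at a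
time therefore telescopes in two ways: the product of `1 - ratio` over all vertices is the full
polynomial, and each ratio satisfies Weitz's recursion without truncation.

Compare three families: the complex ratios at `p`, the real ratios `r` at `t = |p|`, and the real
ratios `s` at `(1 + α) t`. Absence of zeros in the polydisc of radii `(1 + α) t` makes every real
`Z_S` involved positive, so `0 ≤ r ≤ s < 1`, and the recursion shows that `r` dominates the moduli
of both the truncated and the exact complex ratios. Scaling gives `s - r ≥ α r`, so the truncation
error at depth `0` is at most `(s - r) / α`.

The gap `s - r` serves as a potential that contracts along the recursion. With `x_w = (s_w - r_w) /
(1 - r_w)` for the children and `ψ = s / r - 1`, the recursion reads `1 + ψ = (1 + α) ∏ 1 / (1 -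
x_w)`, so `∑ x_w ≤ log (1 + ψ) - log (1 + α)`. This is at most `(1 - δ) ψ` as long as `4 δ ^ 2 ≤ α`:
the quadratic loss in `δ` is paid for by a linear gain in `α`, whence a rate of order `√α`
(`log_one_add_sub_le`, `exactRatio_gap_contraction`). As `s - r ≤ 1 - r ≤ |1 - ratio|`, every factor
of the estimate has relative error at most `(1 - δ) ^ ℓ / α` (`norm_weitzEstimate_sub_le`).

The program evaluates the recursion depth first, keeping the current vertex set as marks in a single
array. Its divisions are legal because truncated ratios have modulus below one, and its cost is the
size of a tree of branching at most `D` and depth `ℓ`, up to lower-order factors (`computesRatio`,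
`stepCount_le`). -/

/-- The independence polynomial of the subgraph induced on `S`. -/
noncomputable def indepSum (G : SimpleGraph (Fin n)) (S : Finset (Fin n)) (z : Fin n → K) : K :=
  open Classical in
  ∑ I ∈ S.powerset.filter (fun J : Finset (Fin n) => G.IsIndepSet (J : Set (Fin n))),
    ∏ v ∈ I, z v

theorem indepSum_univ (G : SimpleGraph (Fin n)) (z : Fin n → ℂ) :
    indepSum G Finset.univ z = indepPoly G z := by
  simp [indepSum, indepPoly]

theorem altIndepPoly_eq (G : SimpleGraph (Fin n)) (p : Fin n → ℂ) :
    altIndepPoly G p = indepPoly G (fun v => -p v) := by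
  simp only [altIndepPoly, indepPoly]
  refine Finset.sum_congr rfl fun I _ => ?_
  rw [Finset.prod_neg]

theorem indepSum_empty (G : SimpleGraph (Fin n)) (z : Fin n → K) : indepSum G ∅ z = 1 := by
  classical
  simp [indepSum, Finset.filter_singleton, SimpleGraph.IsIndepSet]

/-- Zeroing activities outside `S` stays inside any polydisc about the origin, so zero-freeness for
`G` passes to all induced subgraphs. -/
theorem indepSum_eq_indepPoly_indicator (G : SimpleGraph (Fin n)) (S : Finset (Fin n))
    (z : Fin n → ℂ) : indepSum G S z = indepPoly G (fun v => if v ∈ S then z v else 0) := by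
  classical
  simp only [indepSum, indepPoly, Finset.sum_filter]
  rw [← Finset.powerset_univ]
  rw [← Finset.sum_subset (Finset.powerset_mono.2 (Finset.subset_univ S))]
  · refine Finset.sum_congr rfl fun I hI => ?_
    rw [Finset.mem_powerset] at hI
    rw [Finset.prod_congr rfl fun v hv => (if_pos (hI hv)).symm]
  · intro I _ hI
    rw [Finset.mem_powerset, Finset.not_subset] at hI
    obtain ⟨v, hv, hvS⟩ := hI
    rw [Finset.prod_eq_zero hv (if_neg hvS), ite_self]

theorem indepSum_ofReal (G : SimpleGraph (Fin n)) (S : Finset (Fin n)) (t : Fin n → ℝ) :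
    indepSum G S (fun v => (t v : ℂ)) = ((indepSum G S t : ℝ) : ℂ) := by
  simp [indepSum]

-- Independent sets are split by whether they contain `u`; those that do avoid its neighbours.
open Classical in
theorem indepSum_eq_erase_add (G : SimpleGraph (Fin n)) {S : Finset (Fin n)} {u : Fin n}
    (hu : u ∈ S) (z : Fin n → K) :
    indepSum G S z = indepSum G (S.erase u) z +
      z u * indepSum G {x ∈ S.erase u | ¬ G.Adj u x} z := by
  have hu' : u ∉ S.erase u := Finset.notMem_erase u S
  conv_lhs => rw [← Finset.insert_erase hu]
  simp only [indepSum]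
  rw [Finset.sum_filter, Finset.sum_powerset_insert hu', ← Finset.sum_filter, ← Finset.sum_filter,
    Finset.mul_sum]
  congr 1
  refine Finset.sum_congr ?_ fun I hI => ?_
  · ext I
    simp only [Finset.mem_filter, Finset.mem_powerset, Finset.coe_insert]
    constructor
    · rintro ⟨hI, hind⟩
      refine ⟨fun x hx => Finset.mem_filter.2 ⟨hI hx, ?_⟩,
        hind.mono (Set.subset_insert _ _)⟩
      exact hind (Set.mem_insert _ _) (Set.mem_insert_of_mem _ hx)
        (Finset.ne_of_mem_erase (hI hx)).symm
    · rintro ⟨hI, hind⟩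
      refine ⟨hI.trans (Finset.filter_subset _ _), ?_⟩
      refine Set.pairwise_insert.2 ⟨hind, fun b hb _ => ?_⟩
      have := (Finset.mem_filter.1 (hI hb)).2
      exact ⟨this, fun h => this h.symm⟩
  · have hI' : u ∉ I := by
      intro h
      simp only [Finset.mem_filter, Finset.mem_powerset] at hI
      exact absurd (hI.1 h) (by simp)
    rw [Finset.prod_insert hI']

/-- The vertex set of the subproblem of the neighbour `w` of `u` in `S`. -/
noncomputable def childSet (G : SimpleGraph (Fin n)) (S : Finset (Fin n)) (u w : Fin n) :
    Finset (Fin n) :=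
  open Classical in
  {x ∈ S | x ≠ u ∧ ¬ (G.Adj u x ∧ x < w)}

theorem mem_childSet {G : SimpleGraph (Fin n)} {S : Finset (Fin n)} {u w : Fin n}
    (hw : w ∈ S) (h : G.Adj u w) : w ∈ childSet G S u w := by
  simp [childSet, hw, h.ne']

theorem card_childSet_lt (G : SimpleGraph (Fin n)) {S : Finset (Fin n)} {u : Fin n} (hu : u ∈ S)
    (w : Fin n) : (childSet G S u w).card < S.card := by
  classical
  exact Finset.card_lt_card (Finset.filter_ssubset.2 ⟨u, hu, by simp⟩)

/-- The exact occupation ratio of `u` in `S`. -/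
noncomputable def exactRatio (G : SimpleGraph (Fin n)) (p : Fin n → K) (S : Finset (Fin n))
    (u : Fin n) : K :=
  open Classical in
  p u * indepSum G {x ∈ S.erase u | ¬ G.Adj u x} (fun v => -p v) /
    indepSum G (S.erase u) (fun v => -p v)

theorem one_sub_exactRatio (G : SimpleGraph (Fin n)) {p : Fin n → K} {S : Finset (Fin n)}
    {u : Fin n} (hu : u ∈ S) (h : indepSum G (S.erase u) (fun v => -p v) ≠ 0) :
    1 - exactRatio G p S u =
      indepSum G S (fun v => -p v) / indepSum G (S.erase u) (fun v => -p v) := by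
  rw [indepSum_eq_erase_add G hu, exactRatio]
  field_simp
  ring

/-- Elements of `N` are deleted from `A` in increasing order, and consecutive quotients cancel. It
is used with `N` the neighbours of a vertex and with `N` the whole vertex set. -/
theorem prod_div_telescope {ι : Type*} [LinearOrder ι] (f : Finset ι → K)
    (hf : ∀ A, f A ≠ 0) (A N : Finset ι) :
    ∏ w ∈ N, f {x ∈ A | ¬ (x ∈ N ∧ x ≤ w)} / f {x ∈ A | ¬ (x ∈ N ∧ x < w)} =
      f {x ∈ A | x ∉ N} / f A := by
  induction N using Finset.induction_on_max with
  | empty => simp [hf]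
  | insert a N hN ih =>
    have ha : a ∉ N := fun h => lt_irrefl _ (hN a h)
    rw [Finset.prod_insert ha]
    have h₁ : {x ∈ A | ¬ (x ∈ insert a N ∧ x ≤ a)} = {x ∈ A | x ∉ insert a N} := by
      ext x
      have : x ∈ insert a N → x ≤ a := fun h => (Finset.mem_insert.1 h).elim le_of_eq
        fun h => (hN x h).le
      simp only [Finset.mem_filter]
      tauto
    have h₂ : {x ∈ A | ¬ (x ∈ insert a N ∧ x < a)} = {x ∈ A | x ∉ N} := by
      ext x
      have : (x ∈ insert a N ∧ x < a) ↔ x ∈ N :=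
        ⟨fun h => (Finset.mem_insert.1 h.1).resolve_left h.2.ne,
          fun h => ⟨Finset.mem_insert_of_mem h, hN x h⟩⟩
      simp only [Finset.mem_filter, this]
    have h₃ : ∀ w ∈ N, f {x ∈ A | ¬ (x ∈ insert a N ∧ x ≤ w)} /
        f {x ∈ A | ¬ (x ∈ insert a N ∧ x < w)} =
        f {x ∈ A | ¬ (x ∈ N ∧ x ≤ w)} / f {x ∈ A | ¬ (x ∈ N ∧ x < w)} := by
      intro w hw
      have hwa := hN w hw
      congr 2
      all_goals
        ext x
        simp only [Finset.mem_filter, Finset.mem_insert, not_and]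
        grind
    rw [Finset.prod_congr rfl h₃, ih, h₁, h₂, div_mul_div_cancel₀ (hf _)]

-- The quotient defining the ratio telescopes when the neighbours of `u` are deleted from `S \ {u}`
-- in increasing order; each intermediate quotient is the inverse of `1 - ratio` of a child.
open Classical in
theorem exactRatio_eq_prod (G : SimpleGraph (Fin n)) {p : Fin n → K}
    (h : ∀ S, indepSum G S (fun v => -p v) ≠ 0) {S : Finset (Fin n)} {u : Fin n} :
    exactRatio G p S u =
      p u * ∏ w ∈ S with G.Adj u w, 1 / (1 - exactRatio G p (childSet G S u w) w) := by
  have key := prod_div_telescope (fun A => indepSum G A (fun v => -p v)) h (S.erase u)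
    {w ∈ S | G.Adj u w}
  rw [exactRatio, mul_div_assoc]
  congr 1
  have h₁ : {x ∈ S.erase u | x ∉ ({w ∈ S | G.Adj u w} : Finset (Fin n))} =
      {x ∈ S.erase u | ¬ G.Adj u x} := by
    ext x; simp only [Finset.mem_filter, Finset.mem_erase]; tauto
  rw [h₁] at key
  rw [← key]
  refine Finset.prod_congr rfl fun w hw => ?_
  rw [Finset.mem_filter] at hw
  rw [one_sub_exactRatio G (mem_childSet hw.1 hw.2) (h _), one_div_div]
  congr 2
  all_goals
    ext x
    simp only [childSet, Finset.mem_filter, Finset.mem_erase, not_and]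
    have := hw.2.ne'
    grind

theorem occupationRatio_succ (G : SimpleGraph (Fin n)) (p : Fin n → ℂ) (ℓ : ℕ)
    (S : Finset (Fin n)) (u : Fin n) :
    open Classical in occupationRatio G p (ℓ + 1) S u =
      p u * ∏ w ∈ S with G.Adj u w, 1 / (1 - occupationRatio G p ℓ (childSet G S u w) w) := rfl

/-- Vertex sets shrink strictly along the recursion, so at depth `S.card` the truncation has no
effect. Bounds uniform in the depth thereby carry over to exact ratios. -/
theorem occupationRatio_eq_exactRatio (G : SimpleGraph (Fin n)) {p : Fin n → ℂ}
    (h : ∀ S, indepSum G S (fun v => -p v) ≠ 0) (ℓ : ℕ) {S : Finset (Fin n)} {u : Fin n}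
    (hu : u ∈ S) (hS : S.card ≤ ℓ) : occupationRatio G p ℓ S u = exactRatio G p S u := by
  classical
  induction ℓ generalizing S u with
  | zero => simp_all
  | succ ℓ ih =>
    rw [occupationRatio_succ, exactRatio_eq_prod G h]
    congr 1
    refine Finset.prod_congr rfl fun w hw => ?_
    rw [Finset.mem_filter] at hw
    rw [ih (mem_childSet hw.1 hw.2) (by have := card_childSet_lt G hu w; omega)]

theorem prod_one_sub_exactRatio (G : SimpleGraph (Fin n)) {p : Fin n → K}
    (h : ∀ S, indepSum G S (fun v => -p v) ≠ 0) :
    ∏ i : Fin n, (1 - exactRatio G p (Finset.Ici i) i) =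
      indepSum G Finset.univ (fun v => -p v) := by
  have key := prod_div_telescope (fun A => indepSum G A (fun v => -p v)) h
    (Finset.univ : Finset (Fin n)) Finset.univ
  have h0 : ({x | x ∉ Finset.univ} : Finset (Fin n)) = ∅ := by simp
  rw [h0, indepSum_empty, one_div, ← inv_inj, inv_inv, ← Finset.prod_inv_distrib] at key
  rw [← key]
  refine Finset.prod_congr rfl fun i _ => ?_
  rw [one_sub_exactRatio G (by simp) (h _), inv_div]
  congr 2
  · ext x
    simp
  · ext x
    simp only [Finset.mem_Ici, Finset.mem_erase, Finset.mem_filter, Finset.mem_univ, true_and,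
      not_le]
    grind

end Combinatorics

/-! ### Positivity, monotonicity and domination by real ratios. -/

section Shearer

variable {n : ℕ}

/-- Along the segment from `0` to `-t` the polynomial starts at `1`; a nonpositive end value would
force a zero inside the polydisc. -/
theorem indepSum_neg_pos (G : SimpleGraph (Fin n)) {t : Fin n → ℝ} (ht : ∀ v, 0 ≤ t v)
    (h : ∀ z : Fin n → ℂ, (∀ v, ‖z v‖ ≤ t v) → indepPoly G z ≠ 0) (S : Finset (Fin n)) :
    0 < indepSum G S (fun v => -t v) := by
  classical
  by_contra! hneg
  have hcont : Continuous fun x : ℝ => indepSum G S (fun v => x * -t v) := by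
    unfold indepSum
    fun_prop
  have h0 : indepSum G S (fun v => (0 : ℝ) * -t v) = 1 := by
    rw [indepSum, Finset.sum_eq_single_of_mem ∅ (by simp [SimpleGraph.IsIndepSet])]
    · simp
    · intro I _ hI
      obtain ⟨v, hv⟩ := Finset.nonempty_iff_ne_empty.2 hI
      exact Finset.prod_eq_zero hv (by simp)
  have hmem : (0 : ℝ) ∈ Set.Icc (indepSum G S (fun v => (1 : ℝ) * -t v))
      (indepSum G S (fun v => (0 : ℝ) * -t v)) := by
    rw [h0]
    simpa using hneg
  obtain ⟨x, ⟨hx0, hx1⟩, hx⟩ :=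
    intermediate_value_Icc' zero_le_one hcont.continuousOn hmem
  -- The zero on the segment, cut off outside `S`, is a forbidden zero of the full polynomial.
  refine h (fun v => if v ∈ S then ((x * -t v : ℝ) : ℂ) else 0) (fun v => ?_) ?_
  · split_ifs
    · rw [Complex.norm_real, norm_mul, norm_neg, Real.norm_of_nonneg hx0,
        Real.norm_of_nonneg (ht v)]
      exact mul_le_of_le_one_left (ht v) hx1
    · simpa using ht v
  · rw [← indepSum_eq_indepPoly_indicator G S (fun v => ((x * -t v : ℝ) : ℂ)), indepSum_ofReal]
    exact_mod_cast hx

theorem exactRatio_nonneg (G : SimpleGraph (Fin n)) {t : Fin n → ℝ} (ht : ∀ v, 0 ≤ t v)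
    (h : ∀ S, 0 < indepSum G S (fun v => -t v)) (S : Finset (Fin n)) (u : Fin n) :
    0 ≤ exactRatio G t S u :=
  div_nonneg (mul_nonneg (ht u) (h _).le) (h _).le

theorem exactRatio_lt_one (G : SimpleGraph (Fin n)) {t : Fin n → ℝ}
    (h : ∀ S, 0 < indepSum G S (fun v => -t v)) {S : Finset (Fin n)} {u : Fin n} (hu : u ∈ S) :
    exactRatio G t S u < 1 := by
  rw [← sub_pos, one_sub_exactRatio G hu (h _).ne']
  exact div_pos (h _) (h _)

theorem prod_one_div_one_sub_le {ι : Type*} {N : Finset ι} {a b : ι → ℝ}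
    (hab : ∀ i ∈ N, a i ≤ b i) (hb : ∀ i ∈ N, b i < 1) :
    ∏ i ∈ N, 1 / (1 - a i) ≤ ∏ i ∈ N, 1 / (1 - b i) := by
  refine Finset.prod_le_prod (fun i hi => ?_) fun i hi => ?_
  · have := hab i hi
    have := hb i hi
    exact one_div_nonneg.2 (by linarith)
  · have := hab i hi
    have := hb i hi
    exact one_div_le_one_div_of_le (by linarith) (by linarith)

/-- The right side of the exact recursion increases in the activity and in each child ratio below
`1`; induct on the size of `S`. -/
theorem exactRatio_mono (G : SimpleGraph (Fin n)) {t s : Fin n → ℝ} (ht : ∀ v, 0 ≤ t v)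
    (hts : ∀ v, t v ≤ s v) (h : ∀ S, 0 < indepSum G S (fun v => -t v))
    (h' : ∀ S, 0 < indepSum G S (fun v => -s v)) {S : Finset (Fin n)} {u : Fin n} (hu : u ∈ S) :
    exactRatio G t S u ≤ exactRatio G s S u := by
  classical
  induction hk : S.card using Nat.strong_induction_on generalizing S u with
  | _ k ih =>
    rw [exactRatio_eq_prod G (fun S => (h S).ne'), exactRatio_eq_prod G (fun S => (h' S).ne')]
    refine mul_le_mul (hts u) (prod_one_div_one_sub_le ?_ ?_) (Finset.prod_nonneg ?_)
      ((ht u).trans (hts u))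
    all_goals intro w hw
    all_goals rw [Finset.mem_filter] at hw
    · exact ih _ (hk ▸ card_childSet_lt G hu w) (mem_childSet hw.1 hw.2) rfl
    · exact exactRatio_lt_one G h' (mem_childSet hw.1 hw.2)
    · exact one_div_nonneg.2 (sub_nonneg.2 (exactRatio_lt_one G h (mem_childSet hw.1 hw.2)).le)

/-- The leading activity supplies the factor `1 + α`, and the children only increase. This makes the
gap at least `α` times the ratio. -/
theorem mul_exactRatio_le (G : SimpleGraph (Fin n)) {t : Fin n → ℝ} {α : ℝ} (hα : 0 ≤ α)
    (ht : ∀ v, 0 ≤ t v) (h : ∀ S, 0 < indepSum G S (fun v => -t v))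
    (h' : ∀ S, 0 < indepSum G S (fun v => -((1 + α) * t v))) {S : Finset (Fin n)} {u : Fin n} :
    (1 + α) * exactRatio G t S u ≤ exactRatio G (fun v => (1 + α) * t v) S u := by
  classical
  rw [exactRatio_eq_prod G (fun S => (h S).ne'),
    exactRatio_eq_prod G (p := fun v => (1 + α) * t v) (fun S => (h' S).ne'), ← mul_assoc]
  refine mul_le_mul_of_nonneg_left (prod_one_div_one_sub_le ?_ ?_)
    (mul_nonneg (by linarith) (ht u))
  all_goals intro w hw
  all_goals rw [Finset.mem_filter] at hw
  · exact exactRatio_mono G ht (fun v => le_mul_of_one_le_left (ht v) (by linarith)) h h'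
      (mem_childSet hw.1 hw.2)
  · exact exactRatio_lt_one G h' (mem_childSet hw.1 hw.2)

/-! ### Contraction of the gap and decay of the truncation error. -/

/-- The scalar inequality behind the square-root gain in the decay of correlations. -/
theorem log_one_add_sub_le {α δ ψ : ℝ} (hα : 0 < α) (hα1 : α ≤ 1) (hδ : 0 < δ) (hδ2 : δ ≤ 1 / 2)
    (hδα : 4 * δ ^ 2 ≤ α) (hψ : 0 ≤ ψ) :
    Real.log (1 + ψ) - Real.log (1 + α) ≤ (1 - δ) * ψ := by
  -- Tangent line of `log` at `1 / (1 - δ)`, the point of slope `1 - δ`. What remains is `-δ - log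
  -- (1 - δ) ≤ 2 δ ^ 2 ≤ α / 2 ≤ log (1 + α)`.
  have h1 : Real.log ((1 - δ) * (1 + ψ)) ≤ (1 - δ) * (1 + ψ) - 1 :=
    Real.log_le_sub_one_of_pos (mul_pos (by linarith) (by linarith))
  rw [Real.log_mul (by linarith) (by linarith)] at h1
  have h2 := Real.one_sub_inv_le_log_of_pos (show 0 < 1 - δ by linarith)
  have h3 := Real.one_sub_inv_le_log_of_pos (show 0 < 1 + α by linarith)
  have h4 : α / 2 ≤ 1 - (1 + α)⁻¹ := by
    rw [← sub_nonneg]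
    have : 1 - (1 + α)⁻¹ - α / 2 = α * (1 - α) / (2 * (1 + α)) := by
      field_simp
      ring
    rw [this]
    exact div_nonneg (mul_nonneg hα.le (by linarith)) (by linarith)
  have h5 : -δ - 2 * δ ^ 2 ≤ 1 - (1 - δ)⁻¹ := by
    have hd : 0 < 1 - δ := by linarith
    rw [← sub_nonneg]
    have : 1 - (1 - δ)⁻¹ - (-δ - 2 * δ ^ 2) = δ ^ 2 * (1 - 2 * δ) / (1 - δ) := by
      field_simp
      ring
    rw [this]
    exact div_nonneg (mul_nonneg (sq_nonneg _) (by linarith)) hd.le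
  linarith

/-- Take logarithms of the product and use `x ≤ -log (1 - x)`. -/
theorem sum_le_of_prod_one_div_one_sub {ι : Type*} {N : Finset ι} {x : ι → ℝ} {α δ ψ : ℝ}
    (hα : 0 < α) (hα1 : α ≤ 1) (hδ : 0 < δ) (hδ2 : δ ≤ 1 / 2) (hδα : 4 * δ ^ 2 ≤ α)
    (hψ : 0 ≤ ψ) (hx : ∀ i ∈ N, x i < 1)
    (h : (1 + α) * ∏ i ∈ N, 1 / (1 - x i) = 1 + ψ) : ∑ i ∈ N, x i ≤ (1 - δ) * ψ := by
  refine le_trans ?_ (log_one_add_sub_le hα hα1 hδ hδ2 hδα hψ)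
  rw [← h, Real.log_mul (by linarith), add_sub_cancel_left, Real.log_prod]
  · refine Finset.sum_le_sum fun i hi => ?_
    have h1 := Real.log_le_sub_one_of_pos (show 0 < 1 - x i by linarith [hx i hi])
    rw [one_div, Real.log_inv]
    linarith
  · exact fun i hi => (one_div_pos.2 (by linarith [hx i hi])).ne'
  · exact (Finset.prod_pos fun i hi => one_div_pos.2 (by linarith [hx i hi])).ne'

/-- One step of the recursion contracts the gap between the ratios at `t` and at `(1 + α) t`. -/
theorem exactRatio_gap_contraction (G : SimpleGraph (Fin n)) {t : Fin n → ℝ} {α δ : ℝ}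
    (hα : 0 < α) (hα1 : α ≤ 1) (hδ : 0 < δ) (hδ2 : δ ≤ 1 / 2) (hδα : 4 * δ ^ 2 ≤ α)
    (ht : ∀ v, 0 ≤ t v) (h : ∀ S, 0 < indepSum G S (fun v => -t v))
    (h' : ∀ S, 0 < indepSum G S (fun v => -((1 + α) * t v))) {S : Finset (Fin n)} {u : Fin n} :
    open Classical in
    exactRatio G t S u * ∑ w ∈ S with G.Adj u w,
      (exactRatio G (fun v => (1 + α) * t v) (childSet G S u w) w -
        exactRatio G t (childSet G S u w) w) / (1 - exactRatio G t (childSet G S u w) w) ≤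
      (1 - δ) * (exactRatio G (fun v => (1 + α) * t v) S u - exactRatio G t S u) := by
  classical
  set s : Fin n → ℝ := fun v => (1 + α) * t v with hs
  have hgap : (1 + α) * exactRatio G t S u ≤ exactRatio G s S u := mul_exactRatio_le G hα.le ht h h'
  -- A vanishing ratio kills the left side and excludes division by it below.
  rcases (exactRatio_nonneg G ht h S u).eq_or_lt with h0 | hpos
  · rw [← h0] at hgap ⊢
    nlinarith
  have hψ : 0 ≤ exactRatio G s S u / exactRatio G t S u - 1 := by
    rw [sub_nonneg, one_le_div hpos]
    nlinarith
  have hlt : ∀ w ∈ ({w ∈ S | G.Adj u w} : Finset (Fin n)),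
      exactRatio G t (childSet G S u w) w < 1 ∧ exactRatio G s (childSet G S u w) w < 1 := by
    intro w hw
    rw [Finset.mem_filter] at hw
    exact ⟨exactRatio_lt_one G h (mem_childSet hw.1 hw.2),
      exactRatio_lt_one G h' (mem_childSet hw.1 hw.2)⟩
  have key := sum_le_of_prod_one_div_one_sub (N := {w ∈ S | G.Adj u w})
    (x := fun w => (exactRatio G s (childSet G S u w) w -
        exactRatio G t (childSet G S u w) w) / (1 - exactRatio G t (childSet G S u w) w))
    hα hα1 hδ hδ2 hδα hψ ?_ ?_
  · calc _ ≤ exactRatio G t S u * ((1 - δ) * (exactRatio G s S u / exactRatio G t S u - 1)) :=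
          mul_le_mul_of_nonneg_left key hpos.le
      _ = _ := by field_simp
  · intro w hw
    obtain ⟨h1, h2⟩ := hlt w hw
    rw [div_lt_one (by linarith)]
    linarith
  -- Each factor splits as `1 / (1 - s) = 1 / (1 - x) * (1 / (1 - r))`; the second factors rebuild
  -- the ratio at `t`, leaving `s / r`.
  · have hprod : ∏ w ∈ S with G.Adj u w, 1 / (1 - exactRatio G s (childSet G S u w) w) =
        (∏ w ∈ S with G.Adj u w, 1 / (1 - (exactRatio G s (childSet G S u w) w -
          exactRatio G t (childSet G S u w) w) / (1 - exactRatio G t (childSet G S u w) w))) *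
        ∏ w ∈ S with G.Adj u w, 1 / (1 - exactRatio G t (childSet G S u w) w) := by
      rw [← Finset.prod_mul_distrib]
      refine Finset.prod_congr rfl fun w hw => ?_
      obtain ⟨h1, h2⟩ := hlt w hw
      have h1' : 1 - exactRatio G t (childSet G S u w) w ≠ 0 := by linarith
      have h2' : 1 - exactRatio G s (childSet G S u w) w ≠ 0 := by linarith
      have h3 : 1 - (exactRatio G s (childSet G S u w) w - exactRatio G t (childSet G S u w) w) /
          (1 - exactRatio G t (childSet G S u w) w) =
          (1 - exactRatio G s (childSet G S u w) w) / (1 - exactRatio G t (childSet G S u w) w) := by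
        field_simp
        ring
      rw [h3]
      field_simp
    rw [add_sub_cancel, eq_div_iff hpos.ne', exactRatio_eq_prod G (p := s) (fun S => (h' S).ne'),
      hprod]
    conv_lhs => rw [exactRatio_eq_prod G (p := t) (fun S => (h S).ne')]
    simp only [hs]
    ring

/-- Factors are exchanged one at a time, all others being bounded by the common majorants `c`. -/
theorem norm_prod_sub_prod_le {ι : Type*} (N : Finset ι) {a b : ι → ℂ} {c : ι → ℝ}
    (hc : ∀ i ∈ N, 0 < c i) (ha : ∀ i ∈ N, ‖a i‖ ≤ c i) (hb : ∀ i ∈ N, ‖b i‖ ≤ c i) :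
    ‖∏ i ∈ N, a i - ∏ i ∈ N, b i‖ ≤ (∏ i ∈ N, c i) * ∑ i ∈ N, ‖a i - b i‖ / c i := by
  classical
  induction N using Finset.induction_on with
  | empty => simp
  | insert i N hi ih =>
    simp only [Finset.mem_insert, forall_eq_or_imp] at hc ha hb
    rw [Finset.prod_insert hi, Finset.prod_insert hi, Finset.prod_insert hi, Finset.sum_insert hi]
    have h1 := ih hc.2 ha.2 hb.2
    have h2 : ‖∏ i ∈ N, b i‖ ≤ ∏ i ∈ N, c i := by
      rw [norm_prod]
      exact Finset.prod_le_prod (fun _ _ => norm_nonneg _) hb.2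
    calc ‖a i * ∏ i ∈ N, a i - b i * ∏ i ∈ N, b i‖
        = ‖a i * (∏ i ∈ N, a i - ∏ i ∈ N, b i) + (a i - b i) * ∏ i ∈ N, b i‖ := by ring_nf
      _ ≤ ‖a i‖ * ‖∏ i ∈ N, a i - ∏ i ∈ N, b i‖ + ‖a i - b i‖ * ‖∏ i ∈ N, b i‖ := by
          rw [← norm_mul, ← norm_mul]
          exact norm_add_le _ _
      _ ≤ c i * ((∏ i ∈ N, c i) * ∑ i ∈ N, ‖a i - b i‖ / c i) +
          ‖a i - b i‖ * ∏ i ∈ N, c i := by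
          gcongr
          exacts [hc.1.le, ha.1]
      _ = _ := by
          have := hc.1.ne'
          field_simp
          ring

theorem norm_one_div_one_sub_le {x : ℂ} {r : ℝ} (hr : r < 1) (hx : ‖x‖ ≤ r) :
    ‖1 / (1 - x)‖ ≤ 1 / (1 - r) := by
  rw [norm_div, norm_one]
  have := norm_sub_norm_le 1 x
  rw [norm_one] at this
  exact one_div_le_one_div_of_le (by linarith) (by linarith)

theorem norm_one_div_sub_one_div_le {x y : ℂ} {r : ℝ} (hr : r < 1) (hx : ‖x‖ ≤ r)
    (hy : ‖y‖ ≤ r) :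
    ‖1 / (1 - x) - 1 / (1 - y)‖ / (1 / (1 - r)) ≤ ‖x - y‖ / (1 - r) := by
  have hne : ∀ z : ℂ, ‖z‖ ≤ r → 1 - z ≠ 0 := by
    rintro z hz h
    rw [sub_eq_zero] at h
    rw [← h, norm_one] at hz
    linarith
  have h1 : 1 / (1 - x) - 1 / (1 - y) = (1 / (1 - x)) * (1 / (1 - y)) * (x - y) := by
    have := hne x hx
    have := hne y hy
    field_simp
    ring
  have hr' : 0 < 1 - r := by linarith
  rw [h1, norm_mul, norm_mul, div_le_iff₀ (by positivity)]
  calc _ ≤ 1 / (1 - r) * (1 / (1 - r)) * ‖x - y‖ := by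
        gcongr
        exacts [norm_one_div_one_sub_le hr hx, norm_one_div_one_sub_le hr hy]
    _ = _ := by field_simp

/-- The truncation starts from `0`, below every nonnegative ratio, and `|1 / (1 - x)| ≤ 1 / (1 -
|x|)` preserves the domination at each step. -/
theorem norm_occupationRatio_le (G : SimpleGraph (Fin n)) {p : Fin n → ℂ}
    (h : ∀ S, 0 < indepSum G S (fun v => -‖p v‖)) (ℓ : ℕ) {S : Finset (Fin n)} {u : Fin n}
    (hu : u ∈ S) : ‖occupationRatio G p ℓ S u‖ ≤ exactRatio G (fun v => ‖p v‖) S u := by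
  classical
  induction ℓ generalizing S u with
  | zero => simpa [occupationRatio] using exactRatio_nonneg G (fun v => norm_nonneg (p v)) h S u
  | succ ℓ ih =>
    rw [occupationRatio_succ, exactRatio_eq_prod G (fun S => (h S).ne'), norm_mul, norm_prod]
    refine mul_le_mul_of_nonneg_left (Finset.prod_le_prod (fun _ _ => norm_nonneg _) fun w hw => ?_)
      (norm_nonneg _)
    rw [Finset.mem_filter] at hw
    have hw' := mem_childSet hw.1 hw.2
    exact norm_one_div_one_sub_le (exactRatio_lt_one G h hw') (ih hw')

theorem norm_exactRatio_le (G : SimpleGraph (Fin n)) {p : Fin n → ℂ}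
    (hp : ∀ S, indepSum G S (fun v => -p v) ≠ 0)
    (h : ∀ S, 0 < indepSum G S (fun v => -‖p v‖)) {S : Finset (Fin n)} {u : Fin n}
    (hu : u ∈ S) : ‖exactRatio G p S u‖ ≤ exactRatio G (fun v => ‖p v‖) S u := by
  rw [← occupationRatio_eq_exactRatio G hp S.card hu le_rfl]
  exact norm_occupationRatio_le G h _ hu

theorem norm_occupationRatio_sub_exactRatio_le (G : SimpleGraph (Fin n)) {p : Fin n → ℂ} {α δ : ℝ}
    (hα : 0 < α) (hα1 : α ≤ 1) (hδ : 0 < δ) (hδ2 : δ ≤ 1 / 2) (hδα : 4 * δ ^ 2 ≤ α)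
    (hp : ∀ S, indepSum G S (fun v => -p v) ≠ 0)
    (h : ∀ S, 0 < indepSum G S (fun v => -‖p v‖))
    (h' : ∀ S, 0 < indepSum G S (fun v => -((1 + α) * ‖p v‖))) (ℓ : ℕ) {S : Finset (Fin n)}
    {u : Fin n} (hu : u ∈ S) :
    ‖occupationRatio G p ℓ S u - exactRatio G p S u‖ ≤ 1 / α * (1 - δ) ^ ℓ *
      (exactRatio G (fun v => (1 + α) * ‖p v‖) S u - exactRatio G (fun v => ‖p v‖) S u) := by
  classical
  induction ℓ generalizing S u with
  | zero =>
    -- At depth `0` the error is the exact ratio itself, of modulus at most `r ≤ (s - r) / α`; this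
    -- is the source of `1 / α`.
    have h1 := norm_exactRatio_le G hp h hu
    have h2 := mul_exactRatio_le G hα.le (fun v => norm_nonneg (p v)) h h' (S := S) (u := u)
    rw [occupationRatio, zero_sub, norm_neg, pow_zero, mul_one, one_div, ← div_eq_inv_mul,
      le_div_iff₀ hα]
    nlinarith
  | succ ℓ ih =>
    have hδ1 : 0 ≤ 1 - δ := by linarith
    have hb := exactRatio_gap_contraction G hα hα1 hδ hδ2 hδα (fun v => norm_nonneg (p v)) h h'
      (S := S) (u := u)
    set r := exactRatio G (fun v => ‖p v‖) with hr
    set s := exactRatio G (fun v => (1 + α) * ‖p v‖) with hs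
    have hchild : ∀ w ∈ ({w ∈ S | G.Adj u w} : Finset (Fin n)), w ∈ childSet G S u w := by
      intro w hw
      rw [Finset.mem_filter] at hw
      exact mem_childSet hw.1 hw.2
    have hlt : ∀ w ∈ ({w ∈ S | G.Adj u w} : Finset (Fin n)), r (childSet G S u w) w < 1 :=
      fun w hw => exactRatio_lt_one G h (hchild w hw)
    rw [occupationRatio_succ, exactRatio_eq_prod G hp, ← mul_sub, norm_mul]
    calc _ ≤ ‖p u‖ * ((∏ w ∈ S with G.Adj u w, 1 / (1 - r (childSet G S u w) w)) *
          ∑ w ∈ S with G.Adj u w, (1 / α * (1 - δ) ^ ℓ * (s (childSet G S u w) w -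
            r (childSet G S u w) w)) / (1 - r (childSet G S u w) w)) := by
          refine mul_le_mul_of_nonneg_left ((norm_prod_sub_prod_le _ (c := fun w =>
            1 / (1 - r (childSet G S u w) w)) ?_ ?_ ?_).trans
            (mul_le_mul_of_nonneg_left (Finset.sum_le_sum fun w hw => ?_)
              (Finset.prod_nonneg fun w hw => ?_))) (norm_nonneg _)
          · exact fun w hw => one_div_pos.2 (by linarith [hlt w hw])
          · exact fun w hw => norm_one_div_one_sub_le (hlt w hw)
              (norm_occupationRatio_le G h ℓ (hchild w hw))
          · exact fun w hw => norm_one_div_one_sub_le (hlt w hw)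
              (norm_exactRatio_le G hp h (hchild w hw))
          · refine (norm_one_div_sub_one_div_le (hlt w hw)
              (norm_occupationRatio_le G h ℓ (hchild w hw))
              (norm_exactRatio_le G hp h (hchild w hw))).trans ?_
            exact div_le_div_of_nonneg_right (ih (hchild w hw)) (by linarith [hlt w hw])
          · exact one_div_nonneg.2 (by linarith [hlt w hw])
      -- The majorant product together with `‖p u‖` is exactly the ratio at `‖p‖`, which brings the
      -- sum into the form of the contraction lemma.
      _ = 1 / α * (1 - δ) ^ ℓ * (r S u * ∑ w ∈ S with G.Adj u w, (s (childSet G S u w) w -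
            r (childSet G S u w) w) / (1 - r (childSet G S u w) w)) := by
          conv_rhs => rw [hr, exactRatio_eq_prod G (fun S => (h S).ne'), ← hr]
          simp only [mul_div_assoc, ← Finset.mul_sum]
          ring
      _ ≤ 1 / α * (1 - δ) ^ ℓ * ((1 - δ) * (s S u - r S u)) :=
          mul_le_mul_of_nonneg_left hb (by positivity)
      _ = _ := by ring

theorem norm_prod_one_add_sub_one_le {ι : Type*} (N : Finset ι) {a : ι → ℂ} {η : ℝ}
    (ha : ∀ i ∈ N, ‖a i - 1‖ ≤ η) : ‖∏ i ∈ N, a i - 1‖ ≤ (1 + η) ^ N.card - 1 := by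
  classical
  induction N using Finset.induction_on with
  | empty => simp
  | insert i N hi ih =>
    simp only [Finset.mem_insert, forall_eq_or_imp] at ha
    rw [Finset.prod_insert hi, Finset.card_insert_of_notMem hi]
    have h1 := ih ha.2
    have hη : 0 ≤ η := (norm_nonneg _).trans ha.1
    have h2 : ‖a i‖ ≤ 1 + η := by
      have := norm_sub_norm_le (a i) 1
      rw [norm_one] at this
      linarith [ha.1]
    calc ‖a i * ∏ i ∈ N, a i - 1‖ = ‖a i * (∏ i ∈ N, a i - 1) + (a i - 1)‖ := by ring_nf
      _ ≤ ‖a i‖ * ‖∏ i ∈ N, a i - 1‖ + ‖a i - 1‖ := by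
          rw [← norm_mul]
          exact norm_add_le _ _
      _ ≤ (1 + η) * ((1 + η) ^ N.card - 1) + η := by
          gcongr
          exact ha.1
      _ = _ := by ring

/-- Both sides are products over the vertices, so relative errors of the single factors are bounded
and compounded. -/
theorem norm_weitzEstimate_sub_le (G : SimpleGraph (Fin n)) {p : Fin n → ℂ} {α δ : ℝ}
    (hα : 0 < α) (hα1 : α ≤ 1) (hδ : 0 < δ) (hδ2 : δ ≤ 1 / 2) (hδα : 4 * δ ^ 2 ≤ α)
    (hp : ∀ S, indepSum G S (fun v => -p v) ≠ 0)
    (h : ∀ S, 0 < indepSum G S (fun v => -‖p v‖))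
    (h' : ∀ S, 0 < indepSum G S (fun v => -((1 + α) * ‖p v‖))) (ℓ : ℕ) :
    ‖weitzEstimate G p ℓ - indepPoly G (fun v => -p v)‖ ≤
      ((1 + 1 / α * (1 - δ) ^ ℓ) ^ n - 1) * ‖indepPoly G (fun v => -p v)‖ := by
  have hδ1 : 0 ≤ 1 - δ := by linarith
  rw [← indepSum_univ, ← prod_one_sub_exactRatio G hp, weitzEstimate]
  have hlow : ∀ i : Fin n, 1 - exactRatio G (fun v => ‖p v‖) (Finset.Ici i) i ≤
      ‖1 - exactRatio G p (Finset.Ici i) i‖ := by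
    intro i
    have h1 := norm_sub_norm_le 1 (exactRatio G p (Finset.Ici i) i)
    have h2 := norm_exactRatio_le G hp h (Finset.mem_Ici.2 (le_refl i))
    rw [norm_one] at h1
    linarith
  have hpos : ∀ i : Fin n, 0 < 1 - exactRatio G (fun v => ‖p v‖) (Finset.Ici i) i := fun i =>
    sub_pos.2 (exactRatio_lt_one G h (by simp))
  have hne : ∀ i : Fin n, 1 - exactRatio G p (Finset.Ici i) i ≠ 0 := fun i =>
    norm_pos_iff.1 ((hpos i).trans_le (hlow i))
  have key := norm_prod_one_add_sub_one_le Finset.univ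
    (a := fun i : Fin n => (1 - occupationRatio G p ℓ (Finset.Ici i) i) /
      (1 - exactRatio G p (Finset.Ici i) i)) (η := 1 / α * (1 - δ) ^ ℓ) ?_
  · rw [Finset.card_univ, Fintype.card_fin, Finset.prod_div_distrib] at key
    have hne' : ∏ i : Fin n, (1 - exactRatio G p (Finset.Ici i) i) ≠ 0 :=
      Finset.prod_ne_zero_iff.2 fun i _ => hne i
    rw [div_sub_one hne', norm_div, div_le_iff₀ (norm_pos_iff.2 hne')] at key
    exact key
  · intro i _
    have h1 := norm_occupationRatio_sub_exactRatio_le G hα hα1 hδ hδ2 hδα hp h h' ℓ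
      (Finset.mem_Ici.2 (le_refl i))
    rw [div_sub_one (hne i), norm_div, div_le_iff₀ (norm_pos_iff.2 (hne i)), sub_sub_sub_cancel_left,
      norm_sub_rev]
    -- Since `s < 1`, the gap is at most `1 - r`, hence at most the modulus of the exact factor: the
    -- absolute error becomes a relative one.
    refine h1.trans (mul_le_mul_of_nonneg_left (le_trans ?_ (hlow i)) (by positivity))
    have := exactRatio_lt_one G h' (Finset.mem_Ici.2 (le_refl i))
    linarith

end Shearer

/-! ### Choice of the depth, with quantities the machine can compute. -/

section Parameters

/-- The least `m` with `m ^ 2 * α ≥ 1`, that is `⌈1 / √α⌉`. -/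
noncomputable def decayScale (α : ℝ) : ℕ := sInf {m : ℕ | 1 ≤ (m : ℝ) * m * α}

/-- The number of halvings of the error that make it negligible. -/
noncomputable def halvings (n : ℕ) (α ε : ℝ) : ℕ := sInf {k : ℕ | (n : ℝ) + n ≤ 2 ^ k * (ε * α)}

/-- The recursion depth of the algorithm. -/
noncomputable def weitzDepth (n : ℕ) (α ε : ℝ) : ℕ :=
  halvings n α ε * (decayScale α + decayScale α)

theorem decayScale_spec {α : ℝ} (hα : 0 < α) :
    1 ≤ (decayScale α : ℝ) * decayScale α * α := by
  refine Nat.sInf_mem (s := {m : ℕ | 1 ≤ (m : ℝ) * m * α}) ?_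
  obtain ⟨m, hm⟩ := exists_nat_ge (1 / α + 1)
  refine ⟨m, ?_⟩
  have h1 : 1 ≤ (m : ℝ) * α := by
    rw [← div_le_iff₀ hα]
    linarith
  have h2 : 1 ≤ (m : ℝ) := by
    have : 0 < 1 / α := by positivity
    linarith
  show 1 ≤ (m : ℝ) * m * α
  nlinarith

theorem lt_one_of_lt_decayScale {α : ℝ} {i : ℕ} (hi : i < decayScale α) :
    (i : ℝ) * i * α < 1 :=
  not_le.1 fun h => Nat.notMem_of_lt_sInf hi h

theorem decayScale_pos {α : ℝ} (hα : 0 < α) : 0 < decayScale α := by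
  rw [Nat.pos_iff_ne_zero]
  intro h
  have := decayScale_spec hα
  rw [h] at this
  norm_num at this

theorem decayScale_le {α : ℝ} (hα : 0 < α) (hα1 : α ≤ 1) :
    (decayScale α : ℝ) ≤ 2 / Real.sqrt α := by
  have hs : 0 < Real.sqrt α := Real.sqrt_pos.2 hα
  have hs1 : Real.sqrt α ≤ 1 := Real.sqrt_le_one.2 hα1
  obtain ⟨i, hi⟩ := Nat.exists_eq_succ_of_ne_zero (decayScale_pos hα).ne'
  have h1 : (i : ℝ) * i * α < 1 := lt_one_of_lt_decayScale (by omega)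
  have h2 : (i * Real.sqrt α) ^ 2 < 1 := by
    rw [mul_pow, Real.sq_sqrt hα.le]
    linarith
  have h3 : (i : ℝ) * Real.sqrt α < 1 := (sq_lt_one_iff₀ (by positivity)).1 h2
  rw [hi, le_div_iff₀ hs]
  push_cast
  linarith

theorem halvings_spec (n : ℕ) {α ε : ℝ} (hα : 0 < α) (hε : 0 < ε) :
    (n : ℝ) + n ≤ 2 ^ halvings n α ε * (ε * α) := by
  refine Nat.sInf_mem (s := {k : ℕ | (n : ℝ) + n ≤ 2 ^ k * (ε * α)}) ?_
  obtain ⟨k, hk⟩ := pow_unbounded_of_one_lt (((n : ℝ) + n) / (ε * α)) one_lt_two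
  refine ⟨k, ?_⟩
  rw [div_lt_iff₀ (by positivity)] at hk
  exact hk.le

theorem lt_of_lt_halvings {n : ℕ} {α ε : ℝ} {i : ℕ} (hi : i < halvings n α ε) :
    2 ^ i * (ε * α) < (n : ℝ) + n :=
  not_le.1 fun h => Nat.notMem_of_lt_sInf hi h

/-- With `B` the maximum, minimality gives `2 ^ (k - 1) < 2 B`, so `2 ^ k < 4 B ≤ B ^ 3`. -/
theorem two_pow_halvings_le (n : ℕ) {α ε : ℝ} (hα : 0 < α) (hε : 0 < ε) :
    (2 : ℝ) ^ halvings n α ε ≤ (max 2 (n / (ε * α))) ^ 3 := by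
  have hB : (2 : ℝ) ≤ max 2 (n / (ε * α)) := le_max_left _ _
  rcases Nat.eq_zero_or_eq_succ_pred (halvings n α ε) with h | h
  · rw [h, pow_zero]
    exact one_le_pow₀ (by linarith)
  · have h1 : 2 ^ (halvings n α ε).pred * (ε * α) < (n : ℝ) + n := lt_of_lt_halvings (by omega)
    rw [← lt_div_iff₀ (by positivity)] at h1
    have h2 : ((n : ℝ) + n) / (ε * α) ≤ 2 * max 2 (n / (ε * α)) := by
      rw [← two_mul, mul_div_assoc]
      exact mul_le_mul_of_nonneg_left (le_max_right _ _) zero_le_two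
    rw [h, pow_succ]
    nlinarith [mul_nonneg (sub_nonneg.2 hB) (sub_nonneg.2 hB)]

theorem halvings_le (n : ℕ) {α ε : ℝ} (hα : 0 < α) (hε : 0 < ε) :
    (halvings n α ε : ℝ) ≤ 6 * Real.log (max 2 (n / (ε * α))) := by
  have hB : (2 : ℝ) ≤ max 2 (n / (ε * α)) := le_max_left _ _
  have h := Real.log_le_log (by positivity) (two_pow_halvings_le n hα hε)
  rw [Real.log_pow, Real.log_pow] at h
  have h2 := Real.log_two_gt_d9
  have h3 : (0 : ℝ) ≤ halvings n α ε := by positivity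
  push_cast at h
  nlinarith

theorem weitzDepth_le (n : ℕ) {α ε : ℝ} (hα : 0 < α) (hα1 : α ≤ 1) (hε : 0 < ε) :
    (weitzDepth n α ε : ℝ) ≤ 24 * (1 / Real.sqrt α) * Real.log (max 2 (n / (ε * α))) := by
  have h1 := halvings_le n hα hε
  have h2 := decayScale_le hα hα1
  have hs : 0 < Real.sqrt α := Real.sqrt_pos.2 hα
  have hB : 0 ≤ Real.log (max 2 (n / (ε * α))) :=
    Real.log_nonneg (one_le_two.trans (le_max_left _ _))
  rw [weitzDepth]
  push_cast
  calc _ ≤ 6 * Real.log (max 2 (n / (ε * α))) * (2 / Real.sqrt α + 2 / Real.sqrt α) := by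
        gcongr
    _ = _ := by ring

/-- Each block of `2 * decayScale α` levels shrinks the error by at least `exp (-1) ≤ 1 / 2`. -/
theorem decay_pow_weitzDepth_le (n : ℕ) {α ε : ℝ} (hα : 0 < α) :
    (1 - 1 / (2 * decayScale α : ℝ)) ^ weitzDepth n α ε ≤ 1 / 2 ^ halvings n α ε := by
  have hm : (1 : ℝ) ≤ decayScale α := by exact_mod_cast decayScale_pos hα
  have h0 : (0 : ℝ) ≤ 1 - 1 / (2 * decayScale α : ℝ) := by
    rw [sub_nonneg, div_le_one (by positivity)]
    linarith
  have h1 := Real.one_sub_div_pow_le_exp_neg (n := decayScale α + decayScale α) (t := 1)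
    (by push_cast; linarith)
  have h2 : Real.exp (-1) ≤ 1 / 2 := by
    have := Real.exp_neg_one_lt_d9
    linarith
  have h3 : (1 - 1 / (2 * decayScale α : ℝ)) ^ (decayScale α + decayScale α) ≤ 1 / 2 := by
    push_cast at h1
    rw [← two_mul] at h1 ⊢
    rw [← two_mul] at h1
    exact h1.trans h2
  rw [weitzDepth, mul_comm (halvings n α ε), pow_mul, ← one_div_pow]
  exact pow_le_pow_left₀ (pow_nonneg h0 _) h3 _

/-- `(1 + η) ^ n ≤ exp (ε / 2) ≤ 1 / (1 - ε / 2) ≤ 1 + ε`. -/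
theorem one_add_pow_sub_one_le {n : ℕ} {η ε : ℝ} (hη : 0 ≤ η) (hε1 : ε ≤ 1)
    (h : (n : ℝ) * η ≤ ε / 2) : (1 + η) ^ n - 1 ≤ ε := by
  have h1 : (1 + η) ^ n ≤ Real.exp (ε / 2) := by
    calc (1 + η) ^ n ≤ Real.exp η ^ n := by
          gcongr
          linarith [Real.add_one_le_exp η]
      _ = Real.exp (n * η) := (Real.exp_nat_mul _ _).symm
      _ ≤ _ := Real.exp_le_exp.2 h
  have hε : 0 ≤ ε := by
    have : 0 ≤ (n : ℝ) * η := by positivity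
    linarith
  have h2 := Real.add_one_le_exp (-(ε / 2))
  rw [Real.exp_neg] at h2
  have h3 := Real.exp_pos (ε / 2)
  have h4 : (-(ε / 2) + 1) * Real.exp (ε / 2) ≤ 1 := by
    calc _ ≤ (Real.exp (ε / 2))⁻¹ * Real.exp (ε / 2) := by gcongr
      _ = 1 := inv_mul_cancel₀ h3.ne'
  nlinarith

theorem norm_weitzEstimate_weitzDepth_sub_le {n : ℕ} (G : SimpleGraph (Fin n)) {z : Fin n → ℂ}
    {α ε : ℝ} (hα : 0 < α) (hα1 : α ≤ 1) (hε : 0 < ε) (hε1 : ε ≤ 1)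
    (hz : ∀ S, indepSum G S z ≠ 0)
    (h : ∀ S, 0 < indepSum G S (fun v => -‖z v‖))
    (h' : ∀ S, 0 < indepSum G S (fun v => -((1 + α) * ‖z v‖))) :
    ‖weitzEstimate G (fun v => -z v) (weitzDepth n α ε) - indepPoly G z‖ ≤
      ε * ‖indepPoly G z‖ := by
  have hm : (1 : ℝ) ≤ decayScale α := by exact_mod_cast decayScale_pos hα
  have hmα := decayScale_spec hα
  -- With `m = decayScale α` and `δ = 1 / (2 m)`, the condition `4 δ ^ 2 ≤ α` is `1 ≤ m ^ 2 α`.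
  have key := norm_weitzEstimate_sub_le G (p := fun v => -z v) (δ := 1 / (2 * decayScale α : ℝ))
    hα hα1 (by positivity) (by rw [div_le_iff₀ (by positivity)]; linarith)
    (by
      rw [div_pow, one_pow, mul_one_div, div_le_iff₀ (by positivity)]
      nlinarith)
    (by simpa using hz) (by simpa using h) (by simpa using h') (weitzDepth n α ε)
  simp only [neg_neg] at key
  refine key.trans (mul_le_mul_of_nonneg_right ?_ (norm_nonneg _))
  have h1 := decay_pow_weitzDepth_le n (ε := ε) hα
  have h2 := halvings_spec n hα hε
  have h0 : (0 : ℝ) ≤ 1 - 1 / (2 * decayScale α : ℝ) := by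
    rw [sub_nonneg, div_le_one (by positivity)]
    linarith
  refine one_add_pow_sub_one_le (by positivity) hε1 ?_
  calc (n : ℝ) * (1 / α * (1 - 1 / (2 * decayScale α : ℝ)) ^ weitzDepth n α ε)
      ≤ n * (1 / α * (1 / 2 ^ halvings n α ε)) := by gcongr
    _ ≤ ε / 2 := by
      have h3 : (n : ℝ) * (1 / α * (1 / 2 ^ halvings n α ε)) = n / (2 ^ halvings n α ε * α) := by
        field_simp
      rw [h3, div_le_iff₀ (by positivity)]
      linarith

end Parameters

/-! ### A Hoare-style calculus with time bounds. -/

section Machine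

theorem Memory.setInt_ints (m : Memory) (a i x b j : ℕ) :
    (m.setInt a i x).ints b j = if b = a ∧ j = i then x else m.ints b j := by
  simp only [Memory.setInt, Function.update_apply]
  split_ifs <;> simp_all

theorem Memory.setNum_nums (m : Memory) (a i : ℕ) (x : ℂ) (b j : ℕ) :
    (m.setNum a i x).nums b j = if b = a ∧ j = i then x else m.nums b j := by
  simp only [Memory.setNum, Function.update_apply]
  split_ifs <;> simp_all

theorem Memory.setInt_nums (m : Memory) (a i x : ℕ) : (m.setInt a i x).nums = m.nums := rfl

theorem Memory.setNum_ints (m : Memory) (a i : ℕ) (x : ℂ) : (m.setNum a i x).ints = m.ints := rfl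

variable {P : Program} {I : MachineInput}

/-- Command `c` started in `m` halts within `T` steps in a memory satisfying `Q`. -/
def Runs (P : Program) (I : MachineInput) (c : Command) (m : Memory) (T : ℕ)
    (Q : Memory → Prop) : Prop :=
  ∃ (t : ℕ) (m' : Memory), Exec P I c m t m' ∧ t ≤ T ∧ Q m'

theorem Runs.mono {c : Command} {m : Memory} {T T' : ℕ} {Q Q' : Memory → Prop}
    (h : Runs P I c m T Q) (hT : T ≤ T') (hQ : ∀ m', Q m' → Q' m') : Runs P I c m T' Q' := by
  obtain ⟨t, m', he, ht, hq⟩ := h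
  exact ⟨t, m', he, ht.trans hT, hQ m' hq⟩

theorem Runs.skip {m : Memory} {Q : Memory → Prop} (h : Q m) : Runs P I .skip m 1 Q :=
  ⟨1, m, .skip m, le_rfl, h⟩

theorem Runs.setInt {m : Memory} {a : ℕ} {i e : IntExpr} {Q : Memory → Prop}
    (h : Q (m.setInt a (i.eval I m) (e.eval I m))) :
    Runs P I (.setInt a i e) m (i.cost + e.cost + 1) Q :=
  ⟨_, _, .setInt m a i e, le_rfl, h⟩

theorem Runs.setNum {m : Memory} {a : ℕ} {i : IntExpr} {x : NumExpr} {Q : Memory → Prop}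
    (h : Q (m.setNum a (i.eval I m) (x.eval I m))) :
    Runs P I (.setNum a i x) m (i.cost + x.cost + 1) Q :=
  ⟨_, _, .setNum m a i x, le_rfl, h⟩

theorem Runs.setDiv {m : Memory} {a : ℕ} {i : IntExpr} {x y : NumExpr} {Q : Memory → Prop}
    (hy : y.eval I m ≠ 0) (h : Q (m.setNum a (i.eval I m) (x.eval I m / y.eval I m))) :
    Runs P I (.setDiv a i x y) m (i.cost + x.cost + y.cost + 2) Q :=
  ⟨_, _, .setDiv m a i x y hy, le_rfl, h⟩

theorem Runs.seq {c d : Command} {m : Memory} {T T' : ℕ} {Q Q' : Memory → Prop}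
    (hc : Runs P I c m T Q) (hd : ∀ m', Q m' → Runs P I d m' T' Q') :
    Runs P I (.seq c d) m (T + T') Q' := by
  obtain ⟨t, m', he, ht, hq⟩ := hc
  obtain ⟨t', m'', he', ht', hq'⟩ := hd m' hq
  exact ⟨_, _, .seq he he', by omega, hq'⟩

theorem Runs.setInt_seq {d : Command} {m : Memory} {a : ℕ} {i e : IntExpr} {T : ℕ}
    {Q : Memory → Prop} (T' x y : ℕ) (hi : i.eval I m = x) (he : e.eval I m = y)
    (hT : i.cost + e.cost + 1 + T' ≤ T) (hd : Runs P I d (m.setInt a x y) T' Q) :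
    Runs P I (.seq (.setInt a i e) d) m T Q :=
  Runs.mono (Runs.seq (Runs.setInt (Q := (· = m.setInt a x y)) (by rw [hi, he]))
    (by rintro _ rfl; exact hd)) hT (fun _ h => h)

theorem Runs.setNum_seq {d : Command} {m : Memory} {a : ℕ} {i : IntExpr} {e : NumExpr} {T : ℕ}
    {Q : Memory → Prop} (T' x : ℕ) (y : ℂ) (hi : i.eval I m = x) (he : e.eval I m = y)
    (hT : i.cost + e.cost + 1 + T' ≤ T) (hd : Runs P I d (m.setNum a x y) T' Q) :
    Runs P I (.seq (.setNum a i e) d) m T Q :=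
  Runs.mono (Runs.seq (Runs.setNum (Q := (· = m.setNum a x y)) (by rw [hi, he]))
    (by rintro _ rfl; exact hd)) hT (fun _ h => h)

theorem Runs.setDiv_seq {d : Command} {m : Memory} {a : ℕ} {i : IntExpr} {e f : NumExpr} {T : ℕ}
    {Q : Memory → Prop} (T' x : ℕ) (y z : ℂ) (hi : i.eval I m = x) (he : e.eval I m = y)
    (hf : f.eval I m = z) (hz : z ≠ 0) (hT : i.cost + e.cost + f.cost + 2 + T' ≤ T)
    (hd : Runs P I d (m.setNum a x (y / z)) T' Q) :
    Runs P I (.seq (.setDiv a i e f) d) m T Q :=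
  Runs.mono (Runs.seq (Runs.setDiv (Q := (· = m.setNum a x (y / z))) (by rwa [hf])
    (by rw [hi, he, hf])) (by rintro _ rfl; exact hd)) hT (fun _ h => h)

theorem Runs.branch_pos {b : Test} {c d : Command} {m : Memory} {T : ℕ} {Q : Memory → Prop}
    (hb : b.Holds I m) (hc : Runs P I c m T Q) : Runs P I (.branch b c d) m (b.cost + T + 1) Q := by
  obtain ⟨t, m', he, ht, hq⟩ := hc
  exact ⟨_, _, .branchTrue d hb he, by omega, hq⟩

theorem Runs.branch_neg {b : Test} {c d : Command} {m : Memory} {T : ℕ} {Q : Memory → Prop}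
    (hb : ¬ b.Holds I m) (hd : Runs P I d m T Q) :
    Runs P I (.branch b c d) m (b.cost + T + 1) Q := by
  obtain ⟨t, m', he, ht, hq⟩ := hd
  exact ⟨_, _, .branchFalse c hb he, by omega, hq⟩

theorem Runs.call {k : ℕ} {c : Command} {m : Memory} {T : ℕ} {Q : Memory → Prop}
    (hk : P[k]? = some c) (hc : Runs P I c m T Q) : Runs P I (.call k) m (T + 1) Q := by
  obtain ⟨t, m', he, ht, hq⟩ := hc
  exact ⟨_, _, .call hk he, by omega, hq⟩

/-- A loop whose `j`-th iteration takes at most `f j` steps and leads from `Inv j` to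
`Inv (j + 1)`. -/
theorem Runs.loop {b : Test} {c : Command} (N : ℕ) (Inv : ℕ → Memory → Prop) (f : ℕ → ℕ)
    (hstep : ∀ j < N, ∀ m, Inv j m → b.Holds I m ∧ Runs P I c m (f j) (Inv (j + 1)))
    (hend : ∀ m, Inv N m → ¬ b.Holds I m) {m : Memory} (h0 : Inv 0 m) :
    Runs P I (.loop b c) m (∑ j ∈ Finset.range N, f j + (N + 1) * (b.cost + 1)) (Inv N) := by
  induction N generalizing Inv f m with
  | zero => exact ⟨_, _, .loopFalse c (hend m h0), by simp, h0⟩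
  | succ N ih =>
    obtain ⟨hb, t, m', he, ht, hq⟩ := hstep 0 (Nat.succ_pos N) m h0
    obtain ⟨t', m'', he', ht', hq'⟩ := ih (fun j => Inv (j + 1)) (fun j => f (j + 1))
      (fun j hj => hstep (j + 1) (by omega)) hend hq
    refine ⟨_, _, .loopTrue hb he he', ?_, hq'⟩
    rw [Finset.sum_range_succ']
    ring_nf at ht' ⊢
    omega

end Machine

/-! ### The program and its restoring loop. -/

section Program

/-- Entry `0` of an integer array, used as a register. -/
abbrev intReg (a : ℕ) : IntExpr := .load a (.const 0)

/-- The entry of an integer array at the current recursion level. -/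
abbrev intTop (a : ℕ) : IntExpr := .load a (intReg 0)

/-- The body executed for each neighbour of the current vertex: recurse on the neighbour, update
the product and remove the neighbour from the vertex set. -/
def visitBody : Command :=
  .seq (.setInt 4 (.sub (intReg 0) (.const 1)) (intTop 5)) <|
  .seq (.setInt 0 (.const 0) (.sub (intReg 0) (.const 1))) <|
  .seq (.call 1) <|
  .seq (.setInt 0 (.const 0) (.add (intReg 0) (.const 1))) <|
  .seq (.setDiv 1 (intReg 0) (.load 1 (intReg 0))
    (.sub (.ofInt (.const 1)) (.load 1 (.sub (intReg 0) (.const 1))))) <|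
  .setInt 3 (intTop 5) (intReg 0)

/-- One iteration of the loop over all vertices that visits the neighbours. -/
def visitStep : Command :=
  .seq (.branch (.conj (.adj (intTop 4) (intTop 5)) (.intEq (.load 3 (intTop 5)) (.const 0)))
    visitBody .skip) <|
  .setInt 5 (intReg 0) (.add (intTop 5) (.const 1))

/-- One iteration of the loop over all vertices that restores the vertex set. -/
def restoreStep : Command :=
  .seq (.branch (.intEq (.load 3 (intTop 5)) (intReg 0))
    (.setInt 3 (intTop 5) (.const 0)) .skip) <|
  .setInt 5 (intReg 0) (.add (intTop 5) (.const 1))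

/-- The recursive procedure. The level is in the integer array `0`, the removed vertices are
marked with a level in array `3`, the vertex of each level is in array `4`, the loop counter of
each level is in array `5`, and the result of each level is in the complex array `1`. -/
def ratioProcedure : Command :=
  .branch (.intEq (intReg 0) (.const 0)) (.setNum 1 (intReg 0) (.ofInt (.const 0))) <|
  .seq (.setNum 1 (intReg 0) (.sub (.ofInt (.const 0)) (.activity (intTop 4)))) <|
  .seq (.setInt 3 (intTop 4) (intReg 0)) <|
  .seq (.setInt 5 (intReg 0) (.const 0)) <|
  .seq (.loop (.intLt (intTop 5) .vertexCount) visitStep) <|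
  .seq (.setInt 5 (intReg 0) (.const 0)) <|
  .loop (.intLt (intTop 5) .vertexCount) restoreStep

/-- Computation of `decayScale` in array `1`. -/
def scaleLoop : Command :=
  .loop (.reLt (.mul (.mul (.ofInt (intReg 1)) (.ofInt (intReg 1))) .alpha) (.ofInt (.const 1)))
    (.setInt 1 (.const 0) (.add (intReg 1) (.const 1)))

/-- Computation of the recursion depth in array `0`. -/
def depthLoop : Command :=
  .loop (.reLt (.load 2 (.const 0)) (.add (.ofInt .vertexCount) (.ofInt .vertexCount)))
    (.seq (.setNum 2 (.const 0) (.add (.load 2 (.const 0)) (.load 2 (.const 0))))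
      (.setInt 0 (.const 0) (.add (intReg 0) (.add (intReg 1) (intReg 1)))))

/-- One factor of the product in the estimate. -/
def factorStep : Command :=
  .seq (.setInt 4 (intReg 0) (intReg 2)) <|
  .seq (.call 1) <|
  .seq (.setNum 0 (.const 0) (.mul (.load 0 (.const 0))
    (.sub (.ofInt (.const 1)) (.load 1 (intReg 0))))) <|
  .seq (.setInt 3 (intReg 2) (.add (intReg 0) (.const 1))) <|
  .setInt 2 (.const 0) (.add (intReg 2) (.const 1))

/-- The main procedure. -/
def mainProcedure : Command :=
  .seq scaleLoop <|
  .seq (.setNum 2 (.const 0) (.mul .eps .alpha)) <|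
  .seq depthLoop <|
  .seq (.setNum 0 (.const 0) (.ofInt (.const 1))) <|
  .loop (.intLt (intReg 2) .vertexCount) factorStep

/-- The program for the truncated recursion. -/
def weitzProgram : Program := [mainProcedure, ratioProcedure]

/-- The part of the memory that a run of `ratioProcedure` above level `ℓ` and vertex marks do not
affect. -/
structure PreservesAbove (ℓ : ℕ) (m m' : Memory) : Prop where
  level : m'.ints 0 0 = m.ints 0 0
  counter : m'.ints 2 0 = m.ints 2 0
  vertex : ∀ j, ℓ ≤ j → m'.ints 4 j = m.ints 4 j
  cursor : ∀ j, ℓ < j → m'.ints 5 j = m.ints 5 j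
  result : ∀ j, ℓ < j → m'.nums 1 j = m.nums 1 j
  output : m'.nums 0 0 = m.nums 0 0

variable {P : Program} {I : MachineInput}

theorem runs_restoreLoop {ℓ : ℕ} {m : Memory} (hL : m.ints 0 0 = ℓ) (hW : m.ints 5 ℓ = 0) :
    Runs P I (.loop (.intLt (intTop 5) .vertexCount) restoreStep) m (40 * (I.n + 1))
      (fun m' => PreservesAbove ℓ m m' ∧ m'.nums 1 ℓ = m.nums 1 ℓ ∧
        ∀ x < I.n, m'.ints 3 x = if m.ints 3 x = ℓ then 0 else m.ints 3 x) := by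
  refine Runs.mono (Runs.loop I.n (fun j m' => PreservesAbove ℓ m m' ∧ m'.nums 1 ℓ = m.nums 1 ℓ ∧
    m'.ints 5 ℓ = j ∧ ∀ x, m'.ints 3 x = if x < j ∧ m.ints 3 x = ℓ then 0 else m.ints 3 x)
    (fun _ => 30) ?_ ?_ ?_) ?_ ?_
  · rintro j hj m' ⟨hf, hX, hW', hM⟩
    have hL' : m'.ints 0 0 = ℓ := hf.level.trans hL
    refine ⟨by simp [Test.Holds, IntExpr.eval, hL', hW', hj], ?_⟩
    refine Runs.mono (Runs.seq (T := 20) (T' := 10) (Q := fun m'' => PreservesAbove ℓ m m'' ∧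
      m''.nums 1 ℓ = m.nums 1 ℓ ∧ m''.ints 5 ℓ = j ∧
      ∀ x, m''.ints 3 x = if x < j + 1 ∧ m.ints 3 x = ℓ then 0 else m.ints 3 x)
      ?_ ?_) le_rfl (fun _ h => h)
    · by_cases hj' : m.ints 3 j = ℓ
      · refine Runs.mono (Runs.branch_pos ?_ (Runs.setInt (Q := fun m'' => PreservesAbove ℓ m m'' ∧
          m''.nums 1 ℓ = m.nums 1 ℓ ∧ m''.ints 5 ℓ = j ∧
          ∀ x, m''.ints 3 x = if x < j + 1 ∧ m.ints 3 x = ℓ then 0 else m.ints 3 x) ?_))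
          (by simp [Test.cost, IntExpr.cost]) (fun _ h => h)
        · simp [Test.Holds, IntExpr.eval, hL', hW', hM, hj']
        · simp only [IntExpr.eval, hL', hW']
          refine ⟨⟨?_, ?_, ?_, ?_, ?_, ?_⟩, ?_, ?_, ?_⟩
          · simpa [Memory.setInt_ints] using hf.level
          · simpa [Memory.setInt_ints] using hf.counter
          · simpa [Memory.setInt_ints] using hf.vertex
          · simpa [Memory.setInt_ints] using hf.cursor
          · simpa [Memory.setInt_nums] using hf.result
          · simpa [Memory.setInt_nums] using hf.output
          · simpa [Memory.setInt_nums] using hX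
          · simpa [Memory.setInt_ints] using hW'
          · intro x
            simp only [Memory.setInt_ints, hM, true_and]
            grind
      · refine Runs.mono (Runs.branch_neg ?_ (Runs.skip (Q := fun m'' => PreservesAbove ℓ m m'' ∧
          m''.nums 1 ℓ = m.nums 1 ℓ ∧ m''.ints 5 ℓ = j ∧
          ∀ x, m''.ints 3 x = if x < j + 1 ∧ m.ints 3 x = ℓ then 0 else m.ints 3 x) ?_))
          (by simp [Test.cost, IntExpr.cost]) (fun _ h => h)
        · simp [Test.Holds, IntExpr.eval, hL', hW', hM, hj']
        · refine ⟨hf, hX, hW', fun x => ?_⟩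
          rw [hM]
          grind
    · rintro m'' ⟨hf, hX, hW', hM⟩
      have hL' : m''.ints 0 0 = ℓ := hf.level.trans hL
      refine Runs.mono (Runs.setInt ?_) (by simp [IntExpr.cost]) (fun _ h => h)
      simp only [IntExpr.eval, hL', hW']
      refine ⟨⟨?_, ?_, ?_, ?_, ?_, ?_⟩, ?_, ?_, ?_⟩
      · simpa [Memory.setInt_ints] using hf.level
      · simpa [Memory.setInt_ints] using hf.counter
      · simpa [Memory.setInt_ints] using hf.vertex
      · intro k hk
        simpa [Memory.setInt_ints, hk.ne'] using hf.cursor k hk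
      · simpa [Memory.setInt_nums] using hf.result
      · simpa [Memory.setInt_nums] using hf.output
      · simpa [Memory.setInt_nums] using hX
      · simp [Memory.setInt_ints]
      · simpa [Memory.setInt_ints] using hM
  · rintro m' ⟨hf, hX, hW', hM⟩
    have hL' : m'.ints 0 0 = ℓ := hf.level.trans hL
    simp [Test.Holds, IntExpr.eval, hL', hW']
  · exact ⟨⟨rfl, rfl, fun _ _ => rfl, fun _ _ => rfl, fun _ _ => rfl, rfl⟩, rfl, hW, by simp⟩
  · simp [Test.cost, IntExpr.cost]
    omega
  · rintro m' ⟨hf, hX, hW', hM⟩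
    exact ⟨hf, hX, fun x hx => by simp [hM, hx]⟩

end Program

/-! ### Correctness and cost of the recursive procedure. -/

section Recursion

variable {P : Program} {I : MachineInput}

/-- The call of `ratioProcedure` at level `ℓ` computes the truncated ratio within `T` steps. -/
def ComputesRatio (P : Program) (I : MachineInput) (ℓ T : ℕ) : Prop :=
  ∀ (S : Finset (Fin I.n)) (u : Fin I.n), u ∈ S → ∀ m : Memory, m.ints 0 0 = ℓ →
    m.ints 4 ℓ = u → (∀ x : Fin I.n, m.ints 3 x = 0 ↔ x ∈ S) →
    (∀ x : Fin I.n, x ∉ S → ℓ < m.ints 3 x) →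
    Runs P I (.call 1) m T (fun m' => PreservesAbove ℓ m m' ∧
      m'.nums 1 ℓ = occupationRatio I.G (fun v => -I.z v) ℓ S u ∧
      ∀ x : Fin I.n, m'.ints 3 x = m.ints 3 x)

/-- The child works one level lower, so the parent's cursor and partial product survive the call.
Marking `w` only afterwards leaves it in its own subproblem and removes it from later ones. -/
theorem runs_visitBody {ℓ T : ℕ} (hT : ComputesRatio P I ℓ T) {A : Finset (Fin I.n)}
    {w : Fin I.n} (hw : w ∈ A)
    (hne : occupationRatio I.G (fun v => -I.z v) ℓ A w ≠ 1) {m : Memory}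
    (hL : m.ints 0 0 = ℓ + 1) (hW : m.ints 5 (ℓ + 1) = w)
    (hA : ∀ x : Fin I.n, m.ints 3 x = 0 ↔ x ∈ A)
    (hA' : ∀ x : Fin I.n, x ∉ A → ℓ < m.ints 3 x) :
    Runs P I visitBody m (T + 60) (fun m' => PreservesAbove (ℓ + 1) m m' ∧
      m'.ints 5 (ℓ + 1) = w ∧
      m'.nums 1 (ℓ + 1) =
        m.nums 1 (ℓ + 1) * (1 / (1 - occupationRatio I.G (fun v => -I.z v) ℓ A w)) ∧
      ∀ x : Fin I.n, m'.ints 3 x = if x = w then ℓ + 1 else m.ints 3 x) := by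
  refine Runs.setInt_seq (T + 52) ℓ w (by simp [IntExpr.eval, hL]) (by simp [IntExpr.eval, hL, hW])
    (by simp [IntExpr.cost]; omega) ?_
  refine Runs.setInt_seq (T + 46) 0 ℓ rfl (by simp [IntExpr.eval, Memory.setInt_ints, hL])
    (by simp [IntExpr.cost]; omega) ?_
  refine Runs.mono (Runs.seq (T' := 46) (hT A w hw _ (by simp [Memory.setInt_ints])
    (by simp [Memory.setInt_ints]) (by simpa [Memory.setInt_ints] using hA)
    (by simpa [Memory.setInt_ints] using hA')) ?_) le_rfl (fun _ h => h)
  rintro m₂ ⟨hf, hX, hM⟩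
  have hL₂ : m₂.ints 0 0 = ℓ := by simpa [Memory.setInt_ints] using hf.level
  have hW₂ : m₂.ints 5 (ℓ + 1) = w := by
    simpa [Memory.setInt_ints, hW] using hf.cursor (ℓ + 1) (by omega)
  refine Runs.setInt_seq 40 0 (ℓ + 1) rfl (by simp [IntExpr.eval, hL₂])
    (by simp [IntExpr.cost]) ?_
  refine Runs.setDiv_seq 20 (ℓ + 1) (m₂.nums 1 (ℓ + 1))
    (1 - occupationRatio I.G (fun v => -I.z v) ℓ A w) (by simp [IntExpr.eval, Memory.setInt_ints])
    (by simp [NumExpr.eval, IntExpr.eval, Memory.setInt_ints, Memory.setInt_nums])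
    (by simp [NumExpr.eval, IntExpr.eval, Memory.setInt_ints, Memory.setInt_nums, hX])
    (sub_ne_zero.2 hne.symm) (by simp [IntExpr.cost, NumExpr.cost]) ?_
  refine Runs.mono (Runs.setInt ?_) (by simp [IntExpr.cost]) (fun _ h => h)
  simp only [IntExpr.eval, Memory.setInt_ints, Memory.setNum_ints, hW₂, true_and,
    and_self, if_true, Nat.reduceEqDiff, false_and, if_false]
  refine ⟨⟨?_, ?_, ?_, ?_, ?_, ?_⟩, ?_, ?_⟩
  · simp [Memory.setInt_ints, Memory.setNum_ints, hL]
  · simpa [Memory.setInt_ints, Memory.setNum_ints] using hf.counter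
  · intro j hj
    have hj' : j ≠ ℓ := by omega
    simpa [Memory.setInt_ints, Memory.setNum_ints, hj'] using hf.vertex j (by omega)
  · intro j hj
    simpa [Memory.setInt_ints, Memory.setNum_ints] using hf.cursor j (by omega)
  · intro j hj
    simpa [Memory.setInt_nums, Memory.setNum_nums, hj.ne'] using hf.result j (by omega)
  · simpa [Memory.setInt_nums, Memory.setNum_nums] using hf.output
  · have := hf.result (ℓ + 1) (by omega)
    simp only [Memory.setInt_nums] at this
    simp [Memory.setInt_nums, Memory.setNum_nums, this, div_eq_mul_inv]
  · intro x
    have := hM x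
    simp only [Memory.setInt_ints] at this
    simp [this, Fin.val_inj]

/-- The invariant of the loop over the neighbours. -/
def VisitInvariant (I : MachineInput) (ℓ : ℕ) (S : Finset (Fin I.n)) (u : Fin I.n) (m : Memory)
    (μ : Fin I.n → ℕ) (j : ℕ) (m' : Memory) : Prop :=
  open Classical in
  PreservesAbove (ℓ + 1) m m' ∧ m'.ints 5 (ℓ + 1) = j ∧
    (∀ x : Fin I.n, m'.ints 3 x =
      if x = u ∨ (x.val < j ∧ x ∈ S ∧ I.G.Adj u x) then ℓ + 1 else μ x) ∧
    m'.nums 1 (ℓ + 1) = -I.z u * ∏ w ∈ S with I.G.Adj u w ∧ w.val < j,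
      1 / (1 - occupationRatio I.G (fun v => -I.z v) ℓ (childSet I.G S u w) w)

open Classical in
theorem runs_visitStep {ℓ T : ℕ} (hT : ComputesRatio P I ℓ T)
    (hne : ∀ S u, u ∈ S → occupationRatio I.G (fun v => -I.z v) ℓ S u ≠ 1)
    {S : Finset (Fin I.n)} {u : Fin I.n} {m m' : Memory} {μ : Fin I.n → ℕ}
    (hL : m.ints 0 0 = ℓ + 1) (hU : m.ints 4 (ℓ + 1) = u)
    (hS : ∀ x, μ x = 0 ↔ x ∈ S) (hS' : ∀ x, x ∉ S → ℓ + 1 < μ x) (w : Fin I.n)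
    (h : VisitInvariant I ℓ S u m μ w m') :
    Runs P I visitStep m' (100 + if w ∈ S ∧ I.G.Adj u w then T else 0)
      (VisitInvariant I ℓ S u m μ (w + 1)) := by
  obtain ⟨hf, hW, hM, hX⟩ := h
  have hL' : m'.ints 0 0 = ℓ + 1 := hf.level.trans hL
  have hU' : m'.ints 4 (ℓ + 1) = u := (hf.vertex _ le_rfl).trans hU
  -- Only smaller neighbours have been marked so far, so `w` is unmarked exactly when it lies in `S
  -- \ {u}`.
  have hmark : (u = w ∨ I.G.Adj u w) → (m'.ints 3 w = 0 ↔ w ≠ u ∧ w ∈ S) := by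
    intro _
    have := hS w
    rw [hM]
    grind
  refine Runs.mono (Runs.seq (T := 85 + if w ∈ S ∧ I.G.Adj u w then T else 0)
    (Q := fun m'' => PreservesAbove (ℓ + 1) m m'' ∧ m''.ints 5 (ℓ + 1) = w ∧
      (∀ x : Fin I.n, m''.ints 3 x =
        if x = u ∨ (x.val < w + 1 ∧ x ∈ S ∧ I.G.Adj u x) then ℓ + 1 else μ x) ∧
      m''.nums 1 (ℓ + 1) = -I.z u * ∏ v ∈ S with I.G.Adj u v ∧ v.val < w + 1,
        1 / (1 - occupationRatio I.G (fun v => -I.z v) ℓ (childSet I.G S u v) v))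
    ?_ (fun m'' hm'' => Runs.setInt (?_ : VisitInvariant I ℓ S u m μ (w + 1) _)))
    (by simp [IntExpr.cost]; omega) (fun _ h => h)
  · have htest : (Test.conj (.adj (intTop 4) (intTop 5))
        (.intEq (.load 3 (intTop 5)) (.const 0))).Holds I m' ↔ w ∈ S ∧ I.G.Adj u w := by
      simp only [Test.Holds, IntExpr.eval, hL', hU', hW]
      constructor
      · rintro ⟨⟨_, _, hadj⟩, h0⟩
        exact ⟨((hmark (Or.inr hadj)).1 h0).2, hadj⟩
      · rintro ⟨hwS, hadj⟩
        exact ⟨⟨u.2, w.2, hadj⟩, (hmark (Or.inr hadj)).2 ⟨hadj.ne', hwS⟩⟩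
    by_cases hw : w ∈ S ∧ I.G.Adj u w
    · have hchild := mem_childSet hw.1 hw.2
      refine Runs.mono (Runs.branch_pos (htest.2 hw) (runs_visitBody hT hchild (hne _ _ hchild)
        hL' hW ?_ ?_)) (by rw [if_pos hw]; simp [Test.cost, IntExpr.cost]; omega) ?_
      · intro x
        rw [hM]
        have := hS x
        simp only [childSet, Finset.mem_filter, Fin.lt_def]
        grind
      · intro x hx
        rw [hM]
        have := hS' x
        simp only [childSet, Finset.mem_filter, Fin.lt_def] at hx
        grind
      · rintro m'' ⟨hf', hW', hX', hM'⟩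
        refine ⟨⟨hf'.level.trans hf.level, hf'.counter.trans hf.counter,
          fun j hj => (hf'.vertex j hj).trans (hf.vertex j hj),
          fun j hj => (hf'.cursor j hj).trans (hf.cursor j hj),
          fun j hj => (hf'.result j hj).trans (hf.result j hj), hf'.output.trans hf.output⟩,
          hW', fun x => ?_, ?_⟩
        · rw [hM', hM]
          have : x.val < w + 1 ↔ x.val < w ∨ x = w := by
            rw [Nat.lt_succ_iff_lt_or_eq, Fin.val_inj]
          grind
        · have hset : ({v ∈ S | I.G.Adj u v ∧ v.val < w + 1} : Finset (Fin I.n)) =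
              insert w {v ∈ S | I.G.Adj u v ∧ v.val < w} := by
            ext v
            have : v.val < w + 1 ↔ v.val < w ∨ v = w := by
              rw [Nat.lt_succ_iff_lt_or_eq, Fin.val_inj]
            simp only [Finset.mem_filter, Finset.mem_insert]
            grind
          rw [hset, Finset.prod_insert (by simp), hX', hX]
          ring
    · refine Runs.mono (Runs.branch_neg (fun h => hw (htest.1 h)) (Runs.skip ?_))
        (by rw [if_neg hw]; simp [Test.cost, IntExpr.cost]) (fun _ h => h)
      refine ⟨hf, hW, fun x => ?_, ?_⟩
      · rw [hM]
        have : x.val < w + 1 ↔ x.val < w ∨ x = w := by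
          rw [Nat.lt_succ_iff_lt_or_eq, Fin.val_inj]
        grind
      · rw [hX]
        congr 2
        ext v
        have : v.val < w + 1 ↔ v.val < w ∨ v = w := by
          rw [Nat.lt_succ_iff_lt_or_eq, Fin.val_inj]
        simp only [Finset.mem_filter]
        grind
  · obtain ⟨hf, hW, hM, hX⟩ := hm''
    have hL'' : m''.ints 0 0 = ℓ + 1 := hf.level.trans hL
    simp only [IntExpr.eval, hL'', hW]
    refine ⟨⟨?_, ?_, ?_, ?_, ?_, ?_⟩, ?_, ?_, ?_⟩
    · simpa [Memory.setInt_ints] using hf.level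
    · simpa [Memory.setInt_ints] using hf.counter
    · simpa [Memory.setInt_ints] using hf.vertex
    · intro k hk
      simpa [Memory.setInt_ints, hk.ne'] using hf.cursor k hk
    · simpa [Memory.setInt_nums] using hf.result
    · simpa [Memory.setInt_nums] using hf.output
    · simp [Memory.setInt_ints]
    · simpa [Memory.setInt_ints] using hM
    · simpa [Memory.setInt_nums] using hX

-- All `I.n` iterations cost a constant, but only the at most `D` neighbours in `S` pay for a
-- recursive call.
open Classical in
theorem runs_visitLoop {ℓ T D : ℕ} (hT : ComputesRatio P I ℓ T)
    (hne : ∀ S u, u ∈ S → occupationRatio I.G (fun v => -I.z v) ℓ S u ≠ 1)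
    {S : Finset (Fin I.n)} {u : Fin I.n} {m : Memory} {μ : Fin I.n → ℕ}
    (hD : ({w | I.G.Adj u w} : Finset (Fin I.n)).card ≤ D)
    (hL : m.ints 0 0 = ℓ + 1) (hU : m.ints 4 (ℓ + 1) = u)
    (hS : ∀ x, μ x = 0 ↔ x ∈ S) (hS' : ∀ x, x ∉ S → ℓ + 1 < μ x)
    (h : VisitInvariant I ℓ S u m μ 0 m) :
    Runs P I (.loop (.intLt (intTop 5) .vertexCount) visitStep) m (110 * (I.n + 1) + D * T)
      (VisitInvariant I ℓ S u m μ I.n) := by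
  refine Runs.mono (Runs.loop I.n (VisitInvariant I ℓ S u m μ)
    (fun j => 100 + if hj : j < I.n then
      if (⟨j, hj⟩ : Fin I.n) ∈ S ∧ I.G.Adj u ⟨j, hj⟩ then T else 0 else 0) ?_ ?_ h) ?_ (fun _ h => h)
  · intro j hj m' h'
    have hL' : m'.ints 0 0 = ℓ + 1 := h'.1.level.trans hL
    refine ⟨by simp [Test.Holds, IntExpr.eval, hL', h'.2.1, hj], ?_⟩
    rw [dif_pos hj]
    exact runs_visitStep hT hne hL hU hS hS' ⟨j, hj⟩ h'
  · intro m' h'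
    have hL' : m'.ints 0 0 = ℓ + 1 := h'.1.level.trans hL
    simp [Test.Holds, IntExpr.eval, hL', h'.2.1]
  · rw [Finset.sum_range]
    simp only [Fin.is_lt, dif_pos, Fin.eta, Finset.sum_add_distrib, ← Finset.sum_filter,
      Finset.sum_const, smul_eq_mul, Finset.card_univ, Fintype.card_fin]
    have h1 : ({x | x ∈ S ∧ I.G.Adj u x} : Finset (Fin I.n)).card ≤ D := by
      refine (Finset.card_le_card fun x hx => ?_).trans hD
      simp only [Finset.mem_filter] at hx ⊢
      exact ⟨hx.1, hx.2.2⟩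
    have h2 := Nat.mul_le_mul_right T h1
    simp [Test.cost, IntExpr.cost]
    omega

open Classical in
theorem computesRatio_succ (hP : P[1]? = some ratioProcedure) {ℓ T D : ℕ}
    (hT : ComputesRatio P I ℓ T)
    (hne : ∀ S u, u ∈ S → occupationRatio I.G (fun v => -I.z v) ℓ S u ≠ 1)
    (hD : ∀ u, ({w | I.G.Adj u w} : Finset (Fin I.n)).card ≤ D) :
    ComputesRatio P I (ℓ + 1) (250 * (I.n + 1) + D * T) := by
  intro S u hu m hL hU hS hS'
  refine Runs.mono (T := (150 * (I.n + 1) + D * T + 80) + 1) (Runs.call hP ?_) (by omega)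
    (fun _ h => h)
  refine Runs.mono (Runs.branch_neg (T := 150 * (I.n + 1) + D * T + 60)
    (by simp [Test.Holds, IntExpr.eval, hL]) ?_) (by simp [Test.cost, IntExpr.cost]; omega)
    (fun _ h => h)
  refine Runs.setNum_seq (150 * (I.n + 1) + D * T + 45) (ℓ + 1) (-I.z u)
    (by simp [IntExpr.eval, hL]) (by simp [NumExpr.eval, IntExpr.eval, hL, hU])
    (by simp [IntExpr.cost, NumExpr.cost]; omega) ?_
  refine Runs.setInt_seq (150 * (I.n + 1) + D * T + 35) u (ℓ + 1)
    (by simp [IntExpr.eval, Memory.setNum_ints, hL, hU])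
    (by simp [IntExpr.eval, Memory.setNum_ints, hL]) (by simp [IntExpr.cost]; omega) ?_
  refine Runs.setInt_seq (110 * (I.n + 1) + D * T + (40 * (I.n + 1) + 20)) (ℓ + 1) 0
    (by simp [IntExpr.eval, Memory.setInt_ints, Memory.setNum_ints, hL])
    (by simp [IntExpr.eval]) (by simp [IntExpr.cost]; omega) ?_
  set m₁ := ((m.setNum 1 (ℓ + 1) (-I.z u)).setInt 3 u (ℓ + 1)).setInt 5 (ℓ + 1) 0 with hm₁
  refine Runs.seq (runs_visitLoop (S := S) (u := u) (μ := fun x => m.ints 3 x) hT hne (hD u)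
    (by simp [hm₁, Memory.setInt_ints, Memory.setNum_ints, hL])
    (by simp [hm₁, Memory.setInt_ints, Memory.setNum_ints, hU]) hS hS' ?_) ?_
  · refine ⟨⟨rfl, rfl, fun _ _ => rfl, fun _ _ => rfl, fun _ _ => rfl, rfl⟩, ?_, ?_, ?_⟩
    · simp [hm₁, Memory.setInt_ints]
    · intro x
      simp [hm₁, Memory.setInt_ints, Memory.setNum_ints, Fin.val_inj]
    · simp [hm₁, Memory.setInt_nums, Memory.setNum_nums]
  rintro m₂ ⟨hf, hW, hM, hX⟩
  have hL₂ : m₂.ints 0 0 = ℓ + 1 := by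
    rw [hf.level]
    simp [hm₁, Memory.setInt_ints, Memory.setNum_ints, hL]
  refine Runs.setInt_seq (40 * (I.n + 1)) (ℓ + 1) 0 (by simp [IntExpr.eval, hL₂]) rfl
    (by simp [IntExpr.cost]; omega) ?_
  refine Runs.mono (runs_restoreLoop (ℓ := ℓ + 1) ?_ ?_) le_rfl ?_
  · simpa [Memory.setInt_ints] using hL₂
  · simp [Memory.setInt_ints]
  rintro m₃ ⟨hf', hX', hM'⟩
  refine ⟨⟨?_, ?_, ?_, ?_, ?_, ?_⟩, ?_, ?_⟩
  · rw [hf'.level]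
    simpa [Memory.setInt_ints, hL] using hL₂
  · rw [hf'.counter]
    simp only [Memory.setInt_ints, Nat.reduceEqDiff, false_and, if_false, hf.counter]
    simp [hm₁, Memory.setInt_ints, Memory.setNum_ints]
  · intro j hj
    rw [hf'.vertex j hj]
    simp only [Memory.setInt_ints, Nat.reduceEqDiff, false_and, if_false,
      hf.vertex j hj]
    simp [hm₁, Memory.setInt_ints, Memory.setNum_ints]
  · intro j hj
    rw [hf'.cursor j hj]
    simp only [Memory.setInt_ints, hj.ne', and_false, if_false, hf.cursor j hj]
    simp [hm₁, Memory.setInt_ints, Memory.setNum_ints, hj.ne']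
  · intro j hj
    rw [hf'.result j hj, Memory.setInt_nums, hf.result j hj]
    simp [hm₁, Memory.setInt_nums, Memory.setNum_nums, hj.ne']
  · rw [hf'.output, Memory.setInt_nums, hf.output]
    simp [hm₁, Memory.setInt_nums, Memory.setNum_nums]
  · rw [hX', Memory.setInt_nums, hX, occupationRatio_succ]
    congr 2
    ext w
    simp
  -- Marks outside `S` exceed `ℓ + 1` and marks inside `S` were `0`, so clearing the value `ℓ + 1`
  -- undoes exactly the marks made at this level.
  · intro x
    rw [hM' x x.2]
    simp only [Memory.setInt_ints, Nat.reduceEqDiff, false_and, if_false, hM x]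
    have h1 := hS x
    have h2 := hS' x
    have h3 := x.2
    grind

theorem computesRatio_zero (hP : P[1]? = some ratioProcedure) : ComputesRatio P I 0 20 := by
  intro S u hu m hL hU hS hS'
  refine Runs.mono (Runs.call hP (Runs.branch_pos ?_ (Runs.setNum ?_)))
    (by simp [Test.cost, IntExpr.cost, NumExpr.cost]) (fun _ h => h)
  · simp [Test.Holds, IntExpr.eval, hL]
  · simp only [IntExpr.eval, NumExpr.eval, hL, Nat.cast_zero]
    refine ⟨⟨rfl, rfl, fun _ _ => rfl, fun _ _ => rfl, fun j hj => ?_, ?_⟩, ?_, fun _ => rfl⟩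
    · simp [Memory.setNum_nums, hj.ne']
    · simp [Memory.setNum_nums]
    · simp [Memory.setNum_nums, occupationRatio]

open Classical in
theorem computesRatio (hP : P[1]? = some ratioProcedure) {D : ℕ} (hD2 : 2 ≤ D)
    (hne : ∀ ℓ S u, u ∈ S → occupationRatio I.G (fun v => -I.z v) ℓ S u ≠ 1)
    (hD : ∀ u, ({w | I.G.Adj u w} : Finset (Fin I.n)).card ≤ D) (ℓ : ℕ) :
    ComputesRatio P I ℓ (250 * (I.n + 1) * D ^ (2 * ℓ)) := by
  induction ℓ with
  | zero =>
    intro S u hu m hL hU hS hS'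
    exact (computesRatio_zero hP S u hu m hL hU hS hS').mono (by simp; omega) (fun _ h => h)
  | succ ℓ ih =>
    intro S u hu m hL hU hS hS'
    refine (computesRatio_succ hP ih (hne ℓ) hD S u hu m hL hU hS hS').mono ?_ (fun _ h => h)
    have h1 : 1 ≤ D ^ (2 * ℓ) := Nat.one_le_pow _ _ (by omega)
    -- The exponent `2 ℓ` instead of `ℓ` absorbs the overhead of each level, using `2 ≤ D`.
    have h2 : 1 + D * D ^ (2 * ℓ) ≤ D ^ (2 * (ℓ + 1)) := by
      rw [show 2 * (ℓ + 1) = 2 * ℓ + 1 + 1 by ring, pow_succ, pow_succ]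
      nlinarith [Nat.mul_le_mul h1 hD2]
    calc _ = 250 * (I.n + 1) * (1 + D * D ^ (2 * ℓ)) := by ring
      _ ≤ _ := Nat.mul_le_mul_left _ h2

end Recursion

/-! ### The main procedure, the running time and the theorem. -/

section MainProgram

variable {P : Program} {I : MachineInput}

theorem runs_scaleLoop (hα : 0 < I.α) :
    Runs P I scaleLoop Memory.zero (20 * (decayScale I.α + 1)) (fun m =>
      m.ints 1 0 = decayScale I.α ∧ ∀ a, a ≠ 1 → ∀ i, m.ints a i = 0) := by
  refine Runs.mono (Runs.loop (decayScale I.α)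
    (fun j m => m.ints 1 0 = j ∧ ∀ a, a ≠ 1 → ∀ i, m.ints a i = 0) (fun _ => 6) ?_ ?_ ?_) ?_
    (fun _ h => h)
  · rintro j hj m ⟨hm, h0⟩
    refine ⟨?_, Runs.mono (Runs.setInt ?_) (by simp [IntExpr.cost]) (fun _ h => h)⟩
    · have := lt_one_of_lt_decayScale hj
      simp only [Test.Holds, NumExpr.eval, IntExpr.eval, hm]
      exact_mod_cast this
    · simp only [IntExpr.eval, hm]
      exact ⟨by simp [Memory.setInt_ints], fun a ha i => by simp [Memory.setInt_ints, ha, h0 a ha]⟩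
  · rintro m ⟨hm, h0⟩
    have := decayScale_spec hα
    simp only [Test.Holds, NumExpr.eval, IntExpr.eval, hm, not_lt]
    exact_mod_cast this
  · exact ⟨rfl, fun _ _ _ => rfl⟩
  · simp [Test.cost, IntExpr.cost, NumExpr.cost]
    omega

theorem runs_depthLoop (hα : 0 < I.α) (hε : 0 < I.ε) {m : Memory}
    (hm : m.ints 1 0 = decayScale I.α) (h0 : ∀ a, a ≠ 1 → ∀ i, m.ints a i = 0)
    (hT : m.nums 2 0 = I.ε * I.α) :
    Runs P I depthLoop m (40 * (halvings I.n I.α I.ε + 1)) (fun m' =>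
      m'.ints 0 0 = weitzDepth I.n I.α I.ε ∧ m'.ints 2 0 = 0 ∧ ∀ i, m'.ints 3 i = 0) := by
  refine Runs.mono (Runs.loop (halvings I.n I.α I.ε) (fun j m' => m'.ints 1 0 = decayScale I.α ∧
    m'.ints 0 0 = j * (decayScale I.α + decayScale I.α) ∧ m'.ints 2 0 = 0 ∧
    (∀ i, m'.ints 3 i = 0) ∧ m'.nums 2 0 = ((2 ^ j * (I.ε * I.α) : ℝ) : ℂ)) (fun _ => 20)
    ?_ ?_ ?_) ?_ ?_
  · rintro j hj m' ⟨h1, hL, h2, h3, hT'⟩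
    refine ⟨?_, ?_⟩
    · have := lt_of_lt_halvings hj
      simp only [Test.Holds, NumExpr.eval, IntExpr.eval, hT']
      exact_mod_cast this
    · refine Runs.setNum_seq 11 0 _ rfl rfl (by simp [IntExpr.cost, NumExpr.cost]) ?_
      refine Runs.mono (Runs.setInt ?_) (by simp [IntExpr.cost]) (fun _ h => h)
      simp only [IntExpr.eval, NumExpr.eval, Memory.setNum_ints, hL, h1, hT']
      refine ⟨?_, ?_, ?_, ?_, ?_⟩
      · simp [Memory.setInt_ints, Memory.setNum_ints, h1]
      · simp only [Memory.setInt_ints, and_self, if_true]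
        ring
      · simp [Memory.setInt_ints, Memory.setNum_ints, h2]
      · simp [Memory.setInt_ints, Memory.setNum_ints, h3]
      · simp only [Memory.setInt_nums, Memory.setNum_nums, and_self, if_true]
        push_cast
        ring
  · rintro m' ⟨h1, hL, h2, h3, hT'⟩
    have := halvings_spec I.n hα hε
    simp only [Test.Holds, NumExpr.eval, IntExpr.eval, hT', not_lt]
    exact_mod_cast this
  · exact ⟨hm, by simp [h0], h0 2 (by norm_num) 0, h0 3 (by norm_num), by simp [hT]⟩
  · simp [Test.cost, IntExpr.cost, NumExpr.cost]
    omega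
  · rintro m' ⟨-, hL, h2, h3, -⟩
    exact ⟨hL, h2, h3⟩

/-- The invariant of the loop over the factors of the estimate. -/
def FactorInvariant (I : MachineInput) (ℓ j : ℕ) (m : Memory) : Prop :=
  m.ints 0 0 = ℓ ∧ m.ints 2 0 = j ∧
    (∀ x : Fin I.n, m.ints 3 x = if x.val < j then ℓ + 1 else 0) ∧
    m.nums 0 0 = ∏ i : Fin I.n with i.val < j,
      (1 - occupationRatio I.G (fun v => -I.z v) ℓ (Finset.Ici i) i)

/-- Vertices already treated carry the mark `ℓ + 1`, above every level of the recursion, so no call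
clears them and the unmarked set is `Finset.Ici w`. -/
theorem runs_factorStep {ℓ T : ℕ} (hT : ComputesRatio P I ℓ T) (w : Fin I.n) {m : Memory}
    (h : FactorInvariant I ℓ w m) :
    Runs P I factorStep m (T + 60) (FactorInvariant I ℓ (w + 1)) := by
  obtain ⟨hL, hI, hM, hX⟩ := h
  have hlt : ∀ x : Fin I.n, x.val < w + 1 ↔ x = w ∨ x.val < w := fun x => by
    rw [Nat.lt_succ_iff_lt_or_eq, Fin.val_inj, or_comm]
  refine Runs.setInt_seq (T + 50) ℓ w (by simp [IntExpr.eval, hL]) (by simp [IntExpr.eval, hI])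
    (by simp [IntExpr.cost]; omega) ?_
  refine Runs.seq (T' := 50) (hT (Finset.Ici w) w (by simp) _
    (by simp [Memory.setInt_ints, hL]) (by simp [Memory.setInt_ints]) ?_ ?_) ?_
  · intro x
    simp only [Memory.setInt_ints, Nat.reduceEqDiff, false_and, if_false, hM, Finset.mem_Ici,
      Fin.le_def]
    grind
  · intro x hx
    rw [Finset.mem_Ici, Fin.le_def, not_le] at hx
    simp only [Memory.setInt_ints, Nat.reduceEqDiff, false_and, if_false, hM, if_pos hx]
    omega
  rintro m₁ ⟨hf, hR, hM₁⟩
  have hL₁ : m₁.ints 0 0 = ℓ := by simpa [Memory.setInt_ints, hL] using hf.level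
  have hI₁ : m₁.ints 2 0 = w := by simpa [Memory.setInt_ints, hI] using hf.counter
  have hX₁ : m₁.nums 0 0 = m.nums 0 0 := by simpa [Memory.setInt_nums] using hf.output
  refine Runs.setNum_seq 30 0 (m.nums 0 0 *
      (1 - occupationRatio I.G (fun v => -I.z v) ℓ (Finset.Ici w) w)) rfl
    (by simp [NumExpr.eval, IntExpr.eval, hL₁, hX₁, hR]) (by simp [IntExpr.cost, NumExpr.cost]) ?_
  refine Runs.setInt_seq 15 w (ℓ + 1) (by simp [IntExpr.eval, Memory.setNum_ints, hI₁])
    (by simp [IntExpr.eval, Memory.setNum_ints, hL₁]) (by simp [IntExpr.cost]) ?_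
  refine Runs.mono (Runs.setInt ?_) (by simp [IntExpr.cost]) (fun _ h => h)
  refine ⟨?_, ?_, ?_, ?_⟩
  · simp [IntExpr.eval, Memory.setInt_ints, Memory.setNum_ints, hL₁]
  · simp [IntExpr.eval, Memory.setInt_ints, Memory.setNum_ints, hI₁]
  · intro x
    have := hM₁ x
    simp only [Memory.setInt_ints, Nat.reduceEqDiff, false_and, if_false, hM] at this
    simp only [IntExpr.eval, Memory.setInt_ints, Memory.setNum_ints, Nat.reduceEqDiff, false_and,
      if_false, true_and, Fin.val_inj, this, hlt]
    grind
  · have hset : Finset.univ.filter (fun i : Fin I.n => i.val < w + 1) =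
        insert w (Finset.univ.filter fun i : Fin I.n => i.val < w) := by
      ext x
      simp only [Finset.mem_filter, Finset.mem_univ, true_and, Finset.mem_insert, hlt]
    rw [hset, Finset.prod_insert (by simp)]
    simp [Memory.setInt_nums, Memory.setNum_nums, hX, mul_comm]

open Classical in
theorem weitzProgram_runs (hα : 0 < I.α) (hε : 0 < I.ε) {D : ℕ} (hD2 : 2 ≤ D)
    (hne : ∀ ℓ S u, u ∈ S → occupationRatio I.G (fun v => -I.z v) ℓ S u ≠ 1)
    (hD : ∀ u, ({w | I.G.Adj u w} : Finset (Fin I.n)).card ≤ D) :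
    Runs weitzProgram I (.call 0) Memory.zero
      (500 * (decayScale I.α + 1) * (halvings I.n I.α I.ε + 1) * (I.n + 1) ^ 2 *
        D ^ (2 * weitzDepth I.n I.α I.ε))
      (fun m => m.nums 0 0 =
        weitzEstimate I.G (fun v => -I.z v) (weitzDepth I.n I.α I.ε)) := by
  set ℓ := weitzDepth I.n I.α I.ε with hℓ
  set T := 250 * (I.n + 1) * D ^ (2 * ℓ) with hT
  have hcomp : ComputesRatio weitzProgram I ℓ T := computesRatio rfl hD2 hne hD ℓ
  refine Runs.mono (T := (20 * (decayScale I.α + 1) + (40 * (halvings I.n I.α I.ε + 1) +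
    (I.n * (T + 60) + (I.n + 1) * 5 + 20))) + 1) (Runs.call rfl (Runs.seq (runs_scaleLoop hα) ?_))
    ?_ (fun _ h => h)
  · rintro m ⟨hm, h0⟩
    refine Runs.setNum_seq (40 * (halvings I.n I.α I.ε + 1) + (I.n * (T + 60) + (I.n + 1) * 5 + 10))
      0 (I.ε * I.α) rfl rfl (by simp [IntExpr.cost, NumExpr.cost]; omega) ?_
    refine Runs.seq (runs_depthLoop hα hε (by simpa [Memory.setNum_ints] using hm)
      (by simpa [Memory.setNum_ints] using h0) (by simp [Memory.setNum_nums])) ?_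
    rintro m₁ ⟨hL, hI, hM⟩
    refine Runs.setNum_seq (I.n * (T + 60) + (I.n + 1) * 5) 0 1 rfl
      (by simp [NumExpr.eval, IntExpr.eval]) (by simp [IntExpr.cost, NumExpr.cost]; omega) ?_
    refine Runs.mono (Runs.loop I.n (FactorInvariant I ℓ) (fun _ => T + 60) ?_ ?_ ?_) ?_ ?_
    · intro j hj m₂ h
      exact ⟨by simp [Test.Holds, IntExpr.eval, h.2.1, hj], runs_factorStep hcomp ⟨j, hj⟩ h⟩
    · intro m₂ h
      simp [Test.Holds, IntExpr.eval, h.2.1]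
    · exact ⟨by simpa [Memory.setNum_ints] using hL, by simpa [Memory.setNum_ints] using hI,
        by simpa [Memory.setNum_ints] using fun x : Fin I.n => hM x, by simp [Memory.setNum_nums]⟩
    · simp [Test.cost, IntExpr.cost]
    · rintro m₂ ⟨-, -, -, h⟩
      rw [h, weitzEstimate]
      simp
  · have h1 : 1 ≤ D ^ (2 * ℓ) := Nat.one_le_pow _ _ (by omega)
    obtain ⟨E, hE⟩ := Nat.exists_eq_add_of_le h1
    rw [hT, hE]
    generalize decayScale I.α = a
    generalize halvings I.n I.α I.ε = b
    generalize I.n = n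
    have h3 : 20 * (a + 1) + 40 * (b + 1) ≤ 60 * ((a + 1) * (b + 1)) := by nlinarith
    have h4 : n * (250 * (n + 1) * (1 + E) + 60) + (n + 1) * 5 + 20 + 1 + 60 ≤
        440 * ((n + 1) ^ 2 * (1 + E)) := by nlinarith
    have h5 : 1 ≤ (a + 1) * (b + 1) := Nat.mul_pos (Nat.succ_pos _) (Nat.succ_pos _)
    have h6 : 1 ≤ (n + 1) ^ 2 * (1 + E) := Nat.mul_pos (by positivity) (by omega)
    calc _ ≤ 60 * ((a + 1) * (b + 1)) + 440 * ((n + 1) ^ 2 * (1 + E)) := by omega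
      _ ≤ 500 * (((a + 1) * (b + 1)) * ((n + 1) ^ 2 * (1 + E))) := by nlinarith
      _ = _ := by ring

theorem stepCount_le {n d : ℕ} {α ε : ℝ} (hα : 0 < α) (hα1 : α ≤ 1) (hε : 0 < ε) (hε1 : ε ≤ 1) :
    ((500 * (decayScale α + 1) * (halvings n α ε + 1) * (n + 1) ^ 2 *
      (max 2 d) ^ (2 * weitzDepth n α ε) : ℕ) : ℝ) ≤
      (max 2 (n / (ε * α))) ^ (100 * Real.log (max 2 (d : ℝ)) / Real.sqrt α) := by
  have hs : 0 < Real.sqrt α := Real.sqrt_pos.2 hα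
  have hs1 : 1 ≤ 1 / Real.sqrt α := by
    rw [one_le_div hs]
    exact Real.sqrt_le_one.2 hα1
  have hdepth := weitzDepth_le n hα hα1 hε
  have hscale := decayScale_le hα hα1
  have hhalf := two_pow_halvings_le n hα hε
  have hB : (2 : ℝ) ≤ max 2 (n / (ε * α)) := le_max_left _ _
  have hn : (n : ℝ) ≤ max 2 (n / (ε * α)) := by
    refine le_trans ?_ (le_max_right _ _)
    rw [le_div_iff₀ (by positivity)]
    exact mul_le_of_le_one_right (Nat.cast_nonneg n) (mul_le_one₀ hε1 hα.le hα1)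
  set B := max 2 ((n : ℝ) / (ε * α)) with hBdef
  have hD : (2 : ℝ) ≤ max 2 (d : ℝ) := le_max_left _ _
  set D := max 2 (d : ℝ) with hDdef
  have hB0 : 0 < B := by linarith
  have hD0 : 0 < D := by linarith
  have hlog2 := Real.log_two_gt_d9
  have hlB : 0.69 ≤ Real.log B := by
    have := Real.log_le_log two_pos hB
    linarith
  have hlD : 0.69 ≤ Real.log D := by
    have := Real.log_le_log two_pos hD
    linarith
  -- Every factor of the step count is bounded by `exp (c * X)`; the constants `20, 5, 6, 8, 48` add
  -- up to `87 ≤ 100`. Lower bounds on `log D`, `log B` and `1 / √α` let `X` absorb each single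
  -- quantity.
  set X := Real.log D * Real.log B * (1 / Real.sqrt α) with hX
  have hX1 : 1 / Real.sqrt α ≤ 5 / 2 * X := by
    have : 0.4761 ≤ Real.log D * Real.log B := by nlinarith
    rw [hX]
    nlinarith
  have hX2 : Real.log B ≤ 2 * X := by
    have : 0.69 ≤ Real.log D * (1 / Real.sqrt α) := by nlinarith
    rw [hX]
    nlinarith
  have hBX : B ≤ Real.exp (2 * X) := by
    rw [← Real.log_le_iff_le_exp hB0]
    exact hX2
  have e1 : (500 : ℝ) ≤ Real.exp (20 * X) := by
    have h7 : (7 : ℝ) ≤ 20 * X := by linarith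
    refine le_trans ?_ (Real.exp_le_exp.2 h7)
    have := Real.exp_one_gt_d9
    calc (500 : ℝ) ≤ 2.7 ^ 7 := by norm_num
      _ ≤ Real.exp 1 ^ 7 := by gcongr; linarith
      _ = Real.exp 7 := by rw [← Real.exp_nat_mul]; norm_num
  have e2 : (decayScale α : ℝ) + 1 ≤ Real.exp (5 * X) := by
    refine (Real.add_one_le_exp _).trans (Real.exp_le_exp.2 (hscale.trans ?_))
    rw [div_eq_mul_one_div]
    linarith
  have e3 : (halvings n α ε : ℝ) + 1 ≤ Real.exp (6 * X) := by
    have h1 : (halvings n α ε : ℝ) + 1 ≤ 2 ^ halvings n α ε := by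
      exact_mod_cast Nat.lt_two_pow_self
    refine h1.trans (hhalf.trans ((pow_le_pow_left₀ hB0.le hBX 3).trans_eq ?_))
    rw [← Real.exp_nat_mul]
    congr 1
    push_cast
    ring
  have e4 : ((n : ℝ) + 1) ^ 2 ≤ Real.exp (8 * X) := by
    have h1 : (n : ℝ) + 1 ≤ B ^ 2 := by nlinarith
    calc ((n : ℝ) + 1) ^ 2 ≤ (B ^ 2) ^ 2 := by gcongr
      _ ≤ (Real.exp (2 * X) ^ 2) ^ 2 := by gcongr
      _ = _ := by
        rw [← Real.exp_nat_mul, ← Real.exp_nat_mul]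
        congr 1
        push_cast
        ring
  have e5 : D ^ (2 * weitzDepth n α ε) ≤ Real.exp (48 * X) := by
    rw [← Real.exp_log hD0, ← Real.exp_nat_mul, Real.exp_le_exp]
    push_cast
    calc 2 * (weitzDepth n α ε : ℝ) * Real.log D
        ≤ 2 * (24 * (1 / Real.sqrt α) * Real.log B) * Real.log D := by gcongr
      _ = 48 * X := by rw [hX]; ring
  rw [Real.rpow_def_of_pos hB0]
  push_cast
  rw [← hDdef]
  calc _ ≤ Real.exp (20 * X) * Real.exp (5 * X) * Real.exp (6 * X) * Real.exp (8 * X) *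
        Real.exp (48 * X) := by gcongr
    _ = Real.exp (87 * X) := by
      rw [← Real.exp_add, ← Real.exp_add, ← Real.exp_add, ← Real.exp_add]
      congr 1
      ring
    _ ≤ Real.exp (100 * X) := Real.exp_le_exp.2 (by linarith)
    _ = _ := by
      congr 1
      rw [hX]
      ring

theorem weitzEstimate_guarantee {n : ℕ} (G : SimpleGraph (Fin n)) [DecidableRel G.Adj]
    {z : Fin n → ℂ} {α ε : ℝ} (hα : 0 < α) (hα1 : α ≤ 1) (hε : 0 < ε) (hε1 : ε ≤ 1)
    (h : ∀ y : Fin n → ℂ, (∀ v, ‖y v‖ ≤ (1 + α) * ‖z v‖) → indepPoly G y ≠ 0) :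
    ‖weitzEstimate G (fun v => -z v) (weitzDepth n α ε) - indepPoly G z‖ ≤ ε * ‖indepPoly G z‖ ∧
      weitzProgram.OutputsWithin ⟨n, G, z, α, ε⟩
        (weitzEstimate G (fun v => -z v) (weitzDepth n α ε))
        ((max 2 (n / (ε * α))) ^
          (100 * Real.log (max 2 (G.maxDegree : ℝ)) / Real.sqrt α)) := by
  classical
  have hle : ∀ v, ‖z v‖ ≤ (1 + α) * ‖z v‖ := fun v =>
    le_mul_of_one_le_left (norm_nonneg _) (by linarith)
  have hz : ∀ S, indepSum G S z ≠ 0 := by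
    intro S
    rw [indepSum_eq_indepPoly_indicator]
    refine h _ fun v => ?_
    split_ifs
    · exact hle v
    · rw [norm_zero]
      exact (norm_nonneg _).trans (hle v)
  have h₁ : ∀ S, 0 < indepSum G S (fun v => -‖z v‖) :=
    indepSum_neg_pos G (fun v => norm_nonneg _) fun y hy => h y fun v => (hy v).trans (hle v)
  have h₂ : ∀ S, 0 < indepSum G S (fun v => -((1 + α) * ‖z v‖)) :=
    indepSum_neg_pos G (fun v => (norm_nonneg _).trans (hle v)) h
  refine ⟨norm_weitzEstimate_weitzDepth_sub_le G hα hα1 hε hε1 hz h₁ h₂, ?_⟩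
  -- No denominator `1 - ratio` vanishes, so the machine never gets stuck on a division.
  have hne : ∀ ℓ S u, u ∈ S → occupationRatio G (fun v => -z v) ℓ S u ≠ 1 := by
    intro ℓ S u hu heq
    have h3 := norm_occupationRatio_le G (p := fun v => -z v) (by simpa using h₁) ℓ hu
    have h4 := exactRatio_lt_one G (t := fun v => ‖-z v‖) (by simpa using h₁) hu
    rw [heq, norm_one] at h3
    linarith
  have hD : ∀ u, ({w | G.Adj u w} : Finset (Fin n)).card ≤ max 2 G.maxDegree := by
    intro u
    refine le_trans (le_of_eq ?_) ((G.degree_le_maxDegree u).trans (le_max_right 2 _))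
    rw [← SimpleGraph.card_neighborFinset_eq_degree]
    congr 1
    ext w
    simp
  obtain ⟨t, m, he, ht, hm⟩ := weitzProgram_runs (I := ⟨n, G, z, α, ε⟩) hα hε
    (le_max_left 2 G.maxDegree) hne (by convert hD)
  exact ⟨t, m, he, hm, (Nat.cast_le.2 ht).trans (stepCount_le hα hα1 hε hε1)⟩

end MainProgram

theorem mainTheorem1 :
    ∃ (P : Program) (C : ℝ) (depth : ℕ → ℕ → ℝ → ℝ → ℕ), 0 < C ∧
      ∀ (n : ℕ) (G : SimpleGraph (Fin n)) [DecidableRel G.Adj] (d : ℕ) (α ε : ℝ),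
        G.maxDegree = d → 0 < α → α ≤ 1 → 0 < ε → ε ≤ 1 →
        -- the recursion depth
        (depth n d α ε : ℝ) ≤ C * (1 / Real.sqrt α) * Real.log (max 2 (n / (ε * α))) ∧
        -- the guarantee for the independence polynomial at activities `z`
        (∀ z : Fin n → ℂ, (fun v => (1 + α) * ‖z v‖) ∈ shearerRegion G →
          ‖weitzEstimate G (fun v => -z v) (depth n d α ε) - indepPoly G z‖
              ≤ ε * ‖indepPoly G z‖ ∧
          P.OutputsWithin ⟨n, G, z, α, ε⟩ (weitzEstimate G (fun v => -z v) (depth n d α ε))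
            ((max 2 (n / (ε * α))) ^ (C * Real.log (max 2 (d : ℝ)) / Real.sqrt α))) ∧
        -- the guarantee for the alternating-sign independence polynomial at parameters `p`
        (∀ p : Fin n → ℂ, (fun v => (1 + (α : ℂ)) ^ 2 * p v) ∈ complexShearerRegion G →
          ‖weitzEstimate G p (depth n d α ε) - altIndepPoly G p‖ ≤ ε * ‖altIndepPoly G p‖ ∧
          P.OutputsWithin ⟨n, G, fun v => -p v, α, ε⟩ (weitzEstimate G p (depth n d α ε))
            ((max 2 (n / (ε * α))) ^ (C * Real.log (max 2 (d : ℝ)) / Real.sqrt α))) := by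
  refine ⟨weitzProgram, 100, fun n _ α ε => weitzDepth n α ε, by norm_num, ?_⟩
  rintro n G _ d α ε rfl hα hα1 hε hε1
  refine ⟨(weitzDepth_le n hα hα1 hε).trans ?_, fun z hz => ?_, fun p hp => ?_⟩
  · have : 0 ≤ Real.log (max 2 (n / (ε * α))) :=
      Real.log_nonneg (one_le_two.trans (le_max_left _ _))
    gcongr
    norm_num
  · exact weitzEstimate_guarantee G hα hα1 hε hε1 hz.2
  -- One factor `1 + α` of slack already suffices, and `1 + α ≤ (1 + α) ^ 2`.
  · have key := weitzEstimate_guarantee G (z := fun v => -p v) hα hα1 hε hε1 fun y hy =>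
      hp y fun v => (hy v).trans ?_
    · simpa only [neg_neg, altIndepPoly_eq] using key
    · have h1 : ‖(1 + (α : ℂ)) ^ 2‖ = (1 + α) ^ 2 := by
        rw [norm_pow, ← Complex.ofReal_one, ← Complex.ofReal_add, Complex.norm_real,
          Real.norm_of_nonneg (by linarith)]
      rw [norm_neg, norm_mul, h1]
      exact mul_le_mul_of_nonneg_right (by nlinarith) (norm_nonneg _)
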